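/- All vector spaces are over $\mathbb F=\mathbb F_2$ and all operads are symmetric operads in $\mathbb F$-vector spaces. Let $\mathrm{Lev}$ be the operad of level algebras, that is, the operad generated by one binary operation $\star$ subject to the relations $\star=\star\,(1\,2)$ and $\star(\star,\star)=\star(\star,\star)\,(2\,3)$. Let $\mathrm{Com}$ be the operad of (non-unital) commutative associative algebras, with generator $\cdot\in\mathrm{Com}(2)$ and $\mathrm{Com}(0)=0$. For $q\ge 0$, let $\mathrm D=\mathbb F[d]$, $\mathrm D^{\pm}=\mathbb F[d,d^{-1}]$ and $T_q\mathrm D=\mathbb F[d]/(d^{q+1})$, seen as operads concentrated in arity $1$. For $A$ one of these three algebras, $\mathrm{Com}\circ A$, with $(\mathrm{Com}\circ A)(n)=\mathrm{Com}(n)\otimes A^{\otimes n}$, is the operad defined by the distributive law $(d^i;\mu)\mapsto(\mu;d^i,\dots,d^i)$. Let $T_q\mathrm{Lev}$ be the quotient of $\mathrm{Lev}$ by the operadic ideal spanned by all the compositions of copies of $\star$ whose composition tree has height greater than $q$ (the tree with a single vertex has height $1$). **Proposition.** There is a unique morphism of operads $f:\mathrm{Lev}\to\mathrm{Com}\circ\mathrm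 D$ (respectively, $\mathrm{Lev}\to\mathrm{Com}\circ\mathrm D^{\pm}$) sending $\star$ to $(\cdot;d,d)$, and it is a monomorphism, i.e. it is injective in every arity. Moreover, for every $q\ge0$, the morphism $f:\mathrm{Lev}\to\mathrm{Com}\circ\mathrm D$ passes to the quotients: there is a morphism of operads $T_q\mathrm{Lev}\to\mathrm{Com}\circ T_q\mathrm D$ whose composite with the projection $\mathrm{Lev}\to T_q\mathrm{Lev}$ is the composite of $f$ with the projection $\mathrm{Com}\circ\mathrm D\to\mathrm{Com}\circ T_q\mathrm D$, and it is a monomorphism, i.e. it is injective in every arity. -/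

import Mathlib

open scoped TensorProduct Polynomial LaurentPolynomial
open Function

/-- A symmetric operad in `R`-modules. `obj n` is the module of operations with `n` inputs, and
`act x σ` is the right action of `σ` on `x`, whose input `i` is the input `σ i` of `x`.

For `e : (Σ i, Fin (m i)) ≃ Fin n`, `comp e μ ν` is the total composite `μ(ν₁, …, ν_k)`, the
input `j` of `ν i` being given the number `e ⟨i, j⟩`. The usual composite `μ(ν₁, …, ν_k)`, of
arity `∑ i, m i`, is `comp finSigmaFinEquiv μ ν`; by the axiom `comp_relabel` all the others are
obtained from it by the action of the symmetric group. Allowing every numbering of the inputs lets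
one write the axioms without transport along equalities of arities. -/
structure Operad (R : Type) [CommRing R] where
  obj : ℕ → Type
  [addCommGroup : ∀ n, AddCommGroup (obj n)]
  [module : ∀ n, Module R (obj n)]
  act : ∀ {n : ℕ}, obj n → Equiv.Perm (Fin n) → obj n
  one : obj 1
  comp : ∀ {k n : ℕ} {m : Fin k → ℕ}, ((Σ i, Fin (m i)) ≃ Fin n) →
    obj k →ₗ[R] MultilinearMap R (fun i => obj (m i)) (obj n)
  act_add : ∀ {n : ℕ} (x y : obj n) (σ : Equiv.Perm (Fin n)), act (x + y) σ = act x σ + act y σ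
  act_smul : ∀ {n : ℕ} (c : R) (x : obj n) (σ : Equiv.Perm (Fin n)), act (c • x) σ = c • act x σ
  act_one : ∀ {n : ℕ} (x : obj n), act x 1 = x
  act_mul : ∀ {n : ℕ} (x : obj n) (σ τ : Equiv.Perm (Fin n)), act x (σ * τ) = act (act x σ) τ
  comp_relabel : ∀ {k n : ℕ} {m : Fin k → ℕ} (e : (Σ i, Fin (m i)) ≃ Fin n)
    (σ : Equiv.Perm (Fin n)) (μ : obj k) (ν : ∀ i, obj (m i)),
    act (comp e μ ν) σ = comp (e.trans σ.symm) μ ν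
  comp_act_left : ∀ {k n : ℕ} {m : Fin k → ℕ} (σ : Equiv.Perm (Fin k))
    (e : (Σ i, Fin (m (σ i))) ≃ Fin n) (e' : (Σ i, Fin (m i)) ≃ Fin n),
    (∀ i x, e' ⟨σ i, x⟩ = e ⟨i, x⟩) → ∀ (μ : obj k) (ν : ∀ i, obj (m i)),
    comp e (act μ σ) (fun i => ν (σ i)) = comp e' μ ν
  comp_act_right : ∀ {k n : ℕ} {m : Fin k → ℕ} (τ : ∀ i, Equiv.Perm (Fin (m i)))
    (e e' : (Σ i, Fin (m i)) ≃ Fin n),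
    (∀ i x, e' ⟨i, τ i x⟩ = e ⟨i, x⟩) → ∀ (μ : obj k) (ν : ∀ i, obj (m i)),
    comp e μ (fun i => act (ν i) (τ i)) = comp e' μ ν
  one_comp : ∀ {n : ℕ} (e : (Σ _ : Fin 1, Fin n) ≃ Fin n), (∀ x, e ⟨0, x⟩ = x) →
    ∀ ν : obj n, comp e one (fun _ => ν) = ν
  comp_one : ∀ {n : ℕ} (e : (Σ _ : Fin n, Fin 1) ≃ Fin n), (∀ i, e ⟨i, 0⟩ = i) →
    ∀ μ : obj n, comp e μ (fun _ => one) = μ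
  assoc : ∀ {k n N : ℕ} {m : Fin k → ℕ} {l : Fin n → ℕ} {p : Fin k → ℕ}
    (e : (Σ i, Fin (m i)) ≃ Fin n) (e' : (Σ a, Fin (l a)) ≃ Fin N)
    (f : ∀ i, (Σ j : Fin (m i), Fin (l (e ⟨i, j⟩))) ≃ Fin (p i))
    (g : (Σ i, Fin (p i)) ≃ Fin N),
    (∀ i j x, g ⟨i, f i ⟨j, x⟩⟩ = e' ⟨e ⟨i, j⟩, x⟩) →
    ∀ (μ : obj k) (ν : ∀ i, obj (m i)) (ξ : ∀ a, obj (l a)),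
    comp e' (comp e μ ν) ξ = comp g μ (fun i => comp (f i) (ν i) (fun j => ξ (e ⟨i, j⟩)))

namespace Operad

attribute [instance] Operad.addCommGroup Operad.module

variable {R : Type} [CommRing R]

/-- A morphism of operads. -/
structure Hom (P Q : Operad R) where
  app : ∀ n, P.obj n →ₗ[R] Q.obj n
  map_act : ∀ {n : ℕ} (x : P.obj n) (σ : Equiv.Perm (Fin n)),
    app n (P.act x σ) = Q.act (app n x) σ
  map_one : app 1 P.one = Q.one
  map_comp : ∀ {k n : ℕ} {m : Fin k → ℕ} (e : (Σ i, Fin (m i)) ≃ Fin n)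
    (μ : P.obj k) (ν : ∀ i, P.obj (m i)),
    app n (P.comp e μ ν) = Q.comp e (app k μ) (fun i => app (m i) (ν i))

/-- An operadic ideal. -/
structure OpIdeal (P : Operad R) where
  carrier : ∀ n, Submodule R (P.obj n)
  act_mem : ∀ {n : ℕ} (x : P.obj n) (σ : Equiv.Perm (Fin n)), x ∈ carrier n →
    P.act x σ ∈ carrier n
  comp_mem_left : ∀ {k n : ℕ} {m : Fin k → ℕ} (e : (Σ i, Fin (m i)) ≃ Fin n)
    (μ : P.obj k) (ν : ∀ i, P.obj (m i)), μ ∈ carrier k → P.comp e μ ν ∈ carrier n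
  comp_mem_right : ∀ {k n : ℕ} {m : Fin k → ℕ} (e : (Σ i, Fin (m i)) ≃ Fin n)
    (μ : P.obj k) (ν : ∀ i, P.obj (m i)) (i : Fin k), ν i ∈ carrier (m i) →
    P.comp e μ ν ∈ carrier n

/-- The smallest operadic ideal containing the operations in `S`. -/
def OpIdeal.generate (P : Operad R) (S : ∀ n, Set (P.obj n)) : OpIdeal P where
  carrier n := ⨅ (J : OpIdeal P) (_ : ∀ n, S n ⊆ J.carrier n), J.carrier n
  act_mem x σ h := by
    simp only [Submodule.mem_iInf] at h ⊢
    exact fun J hJ => J.act_mem x σ (h J hJ)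
  comp_mem_left e μ ν h := by
    simp only [Submodule.mem_iInf] at h ⊢
    exact fun J hJ => J.comp_mem_left e μ ν (h J hJ)
  comp_mem_right e μ ν i h := by
    simp only [Submodule.mem_iInf] at h ⊢
    exact fun J hJ => J.comp_mem_right e μ ν i (h J hJ)

lemma OpIdeal.comp_sub_mem_right {P : Operad R} (I : OpIdeal P) {k n : ℕ} {m : Fin k → ℕ}
    (e : (Σ i, Fin (m i)) ≃ Fin n) (μ : P.obj k) (ν ν' : ∀ i, P.obj (m i))
    (h : ∀ i, ν i - ν' i ∈ I.carrier (m i)) :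
    P.comp e μ ν - P.comp e μ ν' ∈ I.carrier n := by
  classical
  have key : ∀ s : Finset (Fin k),
      P.comp e μ (s.piecewise ν ν') - P.comp e μ ν' ∈ I.carrier n := by
    intro s
    induction s using Finset.induction_on with
    | empty => simp
    | insert i s hi ih =>
      have h1 : P.comp e μ ((insert i s).piecewise ν ν') - P.comp e μ (s.piecewise ν ν')
          ∈ I.carrier n := by
        have h2 : s.piecewise ν ν' = update (s.piecewise ν ν') i (ν' i) := by
          rw [eq_comm, update_eq_iff]
          exact ⟨by simp [hi], fun _ _ => rfl⟩
        rw [Finset.piecewise_insert]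
        nth_rewrite 2 [h2]
        rw [← MultilinearMap.map_update_sub]
        exact I.comp_mem_right e μ _ i (by simpa using h i)
      simpa using (I.carrier n).add_mem h1 ih
  simpa using key Finset.univ

lemma OpIdeal.comp_sub_mem {P : Operad R} (I : OpIdeal P) {k n : ℕ} {m : Fin k → ℕ}
    (e : (Σ i, Fin (m i)) ≃ Fin n) (μ μ' : P.obj k) (ν ν' : ∀ i, P.obj (m i))
    (hμ : μ - μ' ∈ I.carrier k) (h : ∀ i, ν i - ν' i ∈ I.carrier (m i)) :
    P.comp e μ ν - P.comp e μ' ν' ∈ I.carrier n := by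
  have h1 := I.comp_sub_mem_right e μ ν ν' h
  have h2 := I.comp_mem_left e (μ - μ') ν' hμ
  rw [map_sub, sub_apply] at h2
  simpa using (I.carrier n).add_mem h1 h2

section Quotient

variable (P : Operad R) (I : OpIdeal P)

/-- The composition of a quotient operad. -/
noncomputable def quotComp {k n : ℕ} {m : Fin k → ℕ} (e : (Σ i, Fin (m i)) ≃ Fin n) :
    (P.obj k ⧸ I.carrier k) →ₗ[R]
      MultilinearMap R (fun i => P.obj (m i) ⧸ I.carrier (m i)) (P.obj n ⧸ I.carrier n) :=
  (I.carrier k).liftQ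
    { toFun := fun μ =>
        { toFun := fun ν => (I.carrier n).mkQ (P.comp e μ (fun i => (ν i).out))
          map_update_add' := by
            intro dec ν i x y
            rw [← map_add, Submodule.mkQ_apply, Submodule.mkQ_apply, Submodule.Quotient.eq]
            have hu : ∀ z : P.obj (m i) ⧸ I.carrier (m i),
                (fun j => (update ν i z j).out) = update (fun j => (ν j).out) i z.out := by
              intro z
              funext j
              exact apply_update (fun j (z : P.obj (m j) ⧸ I.carrier (m j)) => z.out) ν i z j
            rw [hu, hu, hu, ← MultilinearMap.map_update_add, ← MultilinearMap.map_update_sub]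
            refine I.comp_mem_right e μ _ i ?_
            rw [update_self, ← Submodule.Quotient.eq]
            simp
          map_update_smul' := by
            intro dec ν i c x
            rw [← map_smul, Submodule.mkQ_apply, Submodule.mkQ_apply, Submodule.Quotient.eq]
            have hu : ∀ z : P.obj (m i) ⧸ I.carrier (m i),
                (fun j => (update ν i z j).out) = update (fun j => (ν j).out) i z.out := by
              intro z
              funext j
              exact apply_update (fun j (z : P.obj (m j) ⧸ I.carrier (m j)) => z.out) ν i z j
            rw [hu, hu, ← MultilinearMap.map_update_smul, ← MultilinearMap.map_update_sub]
            refine I.comp_mem_right e μ _ i ?_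
            rw [update_self, ← Submodule.Quotient.eq]
            simp }
      map_add' := by intro x y; ext ν; simp
      map_smul' := by intro c x; ext ν; simp }
    (by
      intro μ hμ
      ext ν
      simpa using I.comp_mem_left e μ _ hμ)

lemma quotComp_mk {k n : ℕ} {m : Fin k → ℕ} (e : (Σ i, Fin (m i)) ≃ Fin n)
    (μ : P.obj k) (ν : ∀ i, P.obj (m i)) :
    P.quotComp I e ((I.carrier k).mkQ μ) (fun i => (I.carrier (m i)).mkQ (ν i)) =
      (I.carrier n).mkQ (P.comp e μ ν) := by
  change (I.carrier n).mkQ (P.comp e μ _) = _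
  rw [Submodule.mkQ_apply, Submodule.mkQ_apply, Submodule.Quotient.eq]
  refine I.comp_sub_mem_right e μ _ _ fun i => ?_
  rw [← Submodule.Quotient.eq]
  simp

/-- The action on a quotient operad. -/
noncomputable def quotAct {n : ℕ} (σ : Equiv.Perm (Fin n)) :
    (P.obj n ⧸ I.carrier n) →ₗ[R] (P.obj n ⧸ I.carrier n) :=
  (I.carrier n).mapQ (I.carrier n)
    { toFun := fun x => P.act x σ
      map_add' := fun x y => P.act_add x y σ
      map_smul' := fun c x => P.act_smul c x σ }
    (fun x hx => I.act_mem x σ hx)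

lemma quotAct_mk {n : ℕ} (σ : Equiv.Perm (Fin n)) (x : P.obj n) :
    P.quotAct I σ ((I.carrier n).mkQ x) = (I.carrier n).mkQ (P.act x σ) := rfl

lemma exists_mkQ {k : ℕ} {m : Fin k → ℕ} (ν : ∀ i, P.obj (m i) ⧸ I.carrier (m i)) :
    ∃ ν' : ∀ i, P.obj (m i), ν = fun i => (I.carrier (m i)).mkQ (ν' i) :=
  ⟨fun i => (ν i).out, by funext i; simp⟩

/-- The quotient of an operad by an operadic ideal. -/
noncomputable def quotient : Operad R where
  obj n := P.obj n ⧸ I.carrier n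
  act x σ := P.quotAct I σ x
  one := (I.carrier 1).mkQ P.one
  comp e := P.quotComp I e
  act_add x y σ := map_add _ x y
  act_smul c x σ := map_smul _ c x
  act_one {n} x := by
    obtain ⟨x, rfl⟩ := (I.carrier n).mkQ_surjective x
    rw [quotAct_mk, P.act_one]
  act_mul {n} x σ τ := by
    obtain ⟨x, rfl⟩ := (I.carrier n).mkQ_surjective x
    simp only [quotAct_mk, P.act_mul]
  comp_relabel {k n m} e σ μ ν := by
    obtain ⟨μ, rfl⟩ := (I.carrier k).mkQ_surjective μ
    obtain ⟨ν, rfl⟩ := P.exists_mkQ I ν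
    simp only [quotComp_mk, quotAct_mk, P.comp_relabel]
  comp_act_left {k n m} σ e e' h μ ν := by
    obtain ⟨μ, rfl⟩ := (I.carrier k).mkQ_surjective μ
    obtain ⟨ν, rfl⟩ := P.exists_mkQ I ν
    have := P.quotComp_mk I e (P.act μ σ) (fun i => ν (σ i))
    rw [quotAct_mk, this, quotComp_mk, P.comp_act_left σ e e' h]
  comp_act_right {k n m} τ e e' h μ ν := by
    obtain ⟨μ, rfl⟩ := (I.carrier k).mkQ_surjective μ
    obtain ⟨ν, rfl⟩ := P.exists_mkQ I ν
    simp only [quotComp_mk, quotAct_mk]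
    rw [P.comp_act_right τ e e' h]
  one_comp {n} e h ν := by
    obtain ⟨ν, rfl⟩ := (I.carrier n).mkQ_surjective ν
    have := P.quotComp_mk I e P.one (fun _ => ν)
    rw [this, P.one_comp e h]
  comp_one {n} e h μ := by
    obtain ⟨μ, rfl⟩ := (I.carrier n).mkQ_surjective μ
    have := P.quotComp_mk I e μ (fun _ => P.one)
    rw [this, P.comp_one e h]
  assoc {k n N m l p} e e' f g h μ ν ξ := by
    obtain ⟨μ, rfl⟩ := (I.carrier k).mkQ_surjective μ
    obtain ⟨ν, rfl⟩ := P.exists_mkQ I ν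
    obtain ⟨ξ, rfl⟩ := P.exists_mkQ I ξ
    rw [quotComp_mk, quotComp_mk, P.assoc e e' f g h]
    have h1 : ∀ i, P.quotComp I (f i) ((I.carrier (m i)).mkQ (ν i))
        (fun j => (I.carrier (l (e ⟨i, j⟩))).mkQ (ξ (e ⟨i, j⟩))) =
        (I.carrier (p i)).mkQ (P.comp (f i) (ν i) (fun j => ξ (e ⟨i, j⟩))) :=
      fun i => P.quotComp_mk I (f i) (ν i) (fun j => ξ (e ⟨i, j⟩))
    simp only [h1]
    rw [quotComp_mk]

/-- The projection of an operad onto its quotient by an operadic ideal. -/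
noncomputable def proj : Hom P (P.quotient I) where
  app n := (I.carrier n).mkQ
  map_act _ _ := rfl
  map_one := rfl
  map_comp e μ ν := (P.quotComp_mk I e μ ν).symm

end Quotient

end Operad

/-- Planar binary trees with leaves labelled by `α`. -/
inductive BinTree (α : Type) : Type
  | leaf (a : α) : BinTree α
  | node (s t : BinTree α) : BinTree α

namespace BinTree

variable {α β γ : Type}

/-- The labels of the leaves, with multiplicity. -/
def leaves : BinTree α → Multiset α
  | leaf a => {a}
  | node s t => s.leaves + t.leaves

/-- The height: the largest number of vertices on a path from the root to a leaf. -/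
def height : BinTree α → ℕ
  | leaf _ => 0
  | node s t => max s.height t.height + 1

/-- Grafting of the tree `f a` on each leaf labelled by `a`. -/
def bind : BinTree α → (α → BinTree β) → BinTree β
  | leaf a, f => f a
  | node s t, f => node (s.bind f) (t.bind f)

/-- Relabelling of the leaves. -/
def map (f : α → β) (t : BinTree α) : BinTree β := t.bind fun a => leaf (f a)

lemma bind_bind (t : BinTree α) (f : α → BinTree β) (g : β → BinTree γ) :
    (t.bind f).bind g = t.bind fun a => (f a).bind g := by
  induction t with
  | leaf a => rfl
  | node s t hs ht => simp [bind, hs, ht]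

lemma bind_leaf (t : BinTree α) : t.bind leaf = t := by
  induction t with
  | leaf a => rfl
  | node s t hs ht => simp [bind, hs, ht]

lemma leaves_bind (t : BinTree α) (f : α → BinTree β) :
    (t.bind f).leaves = t.leaves.bind fun a => (f a).leaves := by
  induction t with
  | leaf a => simp [bind, leaves]
  | node s t hs ht => simp [bind, leaves, hs, ht]

lemma leaves_map (t : BinTree α) (f : α → β) : (t.map f).leaves = t.leaves.map f := by
  simp [map, leaves_bind, leaves, Multiset.bind_singleton]

end BinTree

/-- Planar binary trees with `n` leaves, labelled bijectively by `Fin n`: the tree monomials of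
arity `n` in one binary operation. -/
abbrev TreeMonomial (n : ℕ) : Type :=
  {t : BinTree (Fin n) // t.leaves = (Finset.univ : Finset (Fin n)).val}

namespace TreeMonomial

/-- Relabelling of the leaves by a permutation. -/
def relabel {n : ℕ} (σ : Equiv.Perm (Fin n)) (t : TreeMonomial n) : TreeMonomial n :=
  ⟨t.1.map σ, by
    rw [BinTree.leaves_map, t.2]
    exact congrArg Finset.val (Finset.map_univ_equiv σ)⟩

/-- Grafting of `s i` on the leaf `i` of `t`, the leaf `j` of `s i` being relabelled by
`e ⟨i, j⟩`. -/
def graft {k n : ℕ} {m : Fin k → ℕ} (e : (Σ i, Fin (m i)) ≃ Fin n)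
    (t : TreeMonomial k) (s : ∀ i, TreeMonomial (m i)) : TreeMonomial n :=
  ⟨t.1.bind fun i => (s i).1.map fun j => e ⟨i, j⟩, by
    have h : ∀ i, ((s i).1.map fun j => e ⟨i, j⟩).leaves =
        (Finset.univ : Finset (Fin (m i))).val.map fun j => e ⟨i, j⟩ := fun i => by
      rw [BinTree.leaves_map, (s i).2]
    rw [BinTree.leaves_bind, t.2]
    simp only [h]
    have h2 : (Finset.univ : Finset (Fin n)) = (Finset.univ : Finset (Σ i, Fin (m i))).map
        e.toEmbedding := (Finset.map_univ_equiv e).symm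
    rw [h2, Finset.map_val, ← Finset.univ_sigma_univ]
    simp only [Finset.sigma, Multiset.sigma, Multiset.map_bind, Multiset.map_map]
    rfl⟩

lemma relabel_relabel {n : ℕ} (σ τ : Equiv.Perm (Fin n)) (t : TreeMonomial n) :
    (t.relabel σ).relabel τ = t.relabel (σ.trans τ) :=
  Subtype.ext (BinTree.bind_bind t.1 _ _)

/-- The trivial tree. -/
def unit : TreeMonomial 1 := ⟨.leaf 0, rfl⟩

/-- The tree with one vertex. -/
def corolla : TreeMonomial 2 := ⟨.node (.leaf 0) (.leaf 1), rfl⟩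

end TreeMonomial

/-- Multilinear functions of elements of free modules that agree on basis elements are equal. -/
lemma multi_ext {R M : Type} [CommRing R] [AddCommGroup M] [Module R M] {k : ℕ}
    {κ : Fin k → Type} {F G : (∀ i, κ i →₀ R) → M}
    (hF : ∀ ν i, IsLinearMap R fun x => F (update ν i x))
    (hG : ∀ ν i, IsLinearMap R fun x => G (update ν i x))
    (h : ∀ s : ∀ i, κ i, F (fun i => Finsupp.single (s i) 1) =
      G (fun i => Finsupp.single (s i) 1)) (ν : ∀ i, κ i →₀ R) : F ν = G ν := by
  let F' : MultilinearMap R (fun i => κ i →₀ R) M :=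
    { toFun := F
      map_update_add' := fun {dec} ν i x y => by
        rw [Subsingleton.elim dec (instDecidableEqFin k)]; exact (hF ν i).map_add x y
      map_update_smul' := fun {dec} ν i c x => by
        rw [Subsingleton.elim dec (instDecidableEqFin k)]; exact (hF ν i).map_smul c x }
  let G' : MultilinearMap R (fun i => κ i →₀ R) M :=
    { toFun := G
      map_update_add' := fun {dec} ν i x y => by
        rw [Subsingleton.elim dec (instDecidableEqFin k)]; exact (hG ν i).map_add x y
      map_update_smul' := fun {dec} ν i c x => by
        rw [Subsingleton.elim dec (instDecidableEqFin k)]; exact (hG ν i).map_smul c x }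
  have : F' = G' := by
    refine Module.Basis.ext_multilinear (fun i => Finsupp.basisSingleOne) fun s => ?_
    simp only [Finsupp.coe_basisSingleOne]
    exact h s
  exact DFunLike.congr_fun this ν

lemma update_sigma {k n : ℕ} {m : Fin k → ℕ} {X : Fin n → Type} {Y : Fin k → Type}
    (e : (Σ i, Fin (m i)) ≃ Fin n) (F : ∀ i, (∀ j : Fin (m i), X (e ⟨i, j⟩)) → Y i)
    (ξ : ∀ a, X a) (i₀ : Fin k) (j₀ : Fin (m i₀)) (x : X (e ⟨i₀, j₀⟩)) :
    (fun i => F i fun j => update ξ (e ⟨i₀, j₀⟩) x (e ⟨i, j⟩)) =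
      update (fun i => F i fun j => ξ (e ⟨i, j⟩)) i₀
        (F i₀ (update (fun j => ξ (e ⟨i₀, j⟩)) j₀ x)) := by
  funext i
  by_cases hi : i = i₀
  · subst hi
    rw [update_self]
    congr 1
    funext j
    by_cases hj : j = j₀
    · subst hj
      simp
    · rw [update_of_ne hj, update_of_ne]
      simpa using hj
  · rw [update_of_ne hi]
    congr 1
    funext j
    rw [update_of_ne]
    intro h
    exact hi (congrArg Sigma.fst (e.injective h))

lemma update_perm {k : ℕ} {X : Fin k → Type} (σ : Equiv.Perm (Fin k)) (ν : ∀ i, X i)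
    (i₀ : Fin k) (x : X (σ i₀)) :
    (fun i => update ν (σ i₀) x (σ i)) = update (fun i => ν (σ i)) i₀ x := by
  funext i
  by_cases hi : i = i₀
  · subst hi
    simp
  · rw [update_of_ne hi, update_of_ne (by simpa using hi)]

namespace Operad

section Magmatic

variable (R : Type) [CommRing R]

open scoped Classical in
/-- The composition of the magmatic operad: the multilinear extension of the grafting of trees. -/
noncomputable def magComp {k n : ℕ} {m : Fin k → ℕ} (e : (Σ i, Fin (m i)) ≃ Fin n) :
    (TreeMonomial k →₀ R) →ₗ[R]
      MultilinearMap R (fun i => TreeMonomial (m i) →₀ R) (TreeMonomial n →₀ R) :=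
  Finsupp.linearCombination R fun t =>
    ((Finsupp.lmapDomain R R (TreeMonomial.graft e t)).comp
      PiTensorProduct.ofFinsuppEquiv'.toLinearMap).compMultilinearMap (PiTensorProduct.tprod R)

lemma magComp_single {k n : ℕ} {m : Fin k → ℕ} (e : (Σ i, Fin (m i)) ≃ Fin n)
    (t : TreeMonomial k) (s : ∀ i, TreeMonomial (m i)) :
    magComp R e (Finsupp.single t 1) (fun i => Finsupp.single (s i) 1) =
      Finsupp.single (TreeMonomial.graft e t s) 1 := by
  simp [magComp]

lemma magComp_isLinear {k n : ℕ} {m : Fin k → ℕ} (e : (Σ i, Fin (m i)) ≃ Fin n)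
    (μ : TreeMonomial k →₀ R) (ν : ∀ i, TreeMonomial (m i) →₀ R) (i : Fin k) :
    IsLinearMap R fun x => magComp R e μ (update ν i x) :=
  ((magComp R e μ).toLinearMap ν i).isLinear

/-- The relabelling action on the magmatic operad. -/
noncomputable def magAct {n : ℕ} (σ : Equiv.Perm (Fin n)) :
    (TreeMonomial n →₀ R) →ₗ[R] (TreeMonomial n →₀ R) :=
  Finsupp.lmapDomain R R (TreeMonomial.relabel σ.symm)

lemma magAct_single {n : ℕ} (σ : Equiv.Perm (Fin n)) (t : TreeMonomial n) :
    magAct R σ (Finsupp.single t 1) = Finsupp.single (t.relabel σ.symm) 1 := by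
  simp [magAct]

lemma finsupp_ext {M : Type} [AddCommGroup M] [Module R M] {κ : Type}
    {F G : (κ →₀ R) → M} (hF : IsLinearMap R F) (hG : IsLinearMap R G)
    (h : ∀ s, F (Finsupp.single s 1) = G (Finsupp.single s 1)) (μ : κ →₀ R) : F μ = G μ := by
  have : hF.mk' F = hG.mk' G := by
    ext s
    simpa using h s
  exact DFunLike.congr_fun this μ

/-- The magmatic operad: the free operad on one binary operation (without symmetry), with basis
the planar binary trees with bijectively labelled leaves. -/
noncomputable def mag : Operad R where
  obj n := TreeMonomial n →₀ R
  act x σ := magAct R σ x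
  one := Finsupp.single TreeMonomial.unit 1
  comp e := magComp R e
  act_add x y σ := map_add _ x y
  act_smul c x σ := map_smul _ c x
  act_one x := by
    refine finsupp_ext R (magAct R 1).isLinear LinearMap.id.isLinear (fun t => ?_) x
    rw [magAct_single]
    congr 1
    exact Subtype.ext (BinTree.bind_leaf t.1)
  act_mul x σ τ := by
    refine finsupp_ext R (magAct R (σ * τ)).isLinear
      ((magAct R τ).comp (magAct R σ)).isLinear (fun t => ?_) x
    rw [LinearMap.comp_apply]
    simp only [magAct_single]
    congr 1
    exact (TreeMonomial.relabel_relabel _ _ t).symm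
  comp_relabel {k n m} e σ μ ν := by
    refine finsupp_ext R (F := fun μ => magAct R σ (magComp R e μ ν))
      (G := fun μ => magComp R (e.trans σ.symm) μ ν)
      ⟨by intros; simp, by intros; simp⟩ ⟨by intros; simp, by intros; simp⟩ (fun t => ?_) μ
    refine multi_ext (F := fun ν => magAct R σ (magComp R e _ ν))
      (fun ν i => ((magAct R σ).comp ((magComp R e _).toLinearMap ν i)).isLinear)
      (magComp_isLinear R _ _) (fun s => ?_) ν
    simp only [magComp_single, magAct_single]
    congr 1
    exact Subtype.ext (by
      simp only [TreeMonomial.relabel, TreeMonomial.graft, BinTree.map, BinTree.bind_bind,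
        BinTree.bind]
      rfl)
  comp_act_left {k n m} σ e e' h μ ν := by
    refine finsupp_ext R (F := fun μ => magComp R e (magAct R σ μ) fun i => ν (σ i))
      (G := fun μ => magComp R e' μ ν)
      ⟨by intros; simp, by intros; simp⟩ ⟨by intros; simp, by intros; simp⟩ (fun t => ?_) μ
    refine multi_ext (F := fun ν => magComp R e (magAct R σ (Finsupp.single t 1)) fun i => ν (σ i))
      (fun ν i => ?_) (magComp_isLinear R _ _) (fun s => ?_) ν
    · obtain ⟨i, rfl⟩ := σ.surjective i
      simp only [update_perm σ ν i]
      exact magComp_isLinear R e _ (fun i => ν (σ i)) i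
    rw [magAct_single, magComp_single R e' t s, magComp_single R e _ fun i => s (σ i)]
    congr 1
    refine Subtype.ext ?_
    simp only [TreeMonomial.relabel, TreeMonomial.graft, BinTree.map, BinTree.bind_bind,
      BinTree.bind, ← h]
    congr 1
    funext a
    exact congrArg (fun b => (s b).1.bind fun x => BinTree.leaf (e' ⟨b, x⟩))
      (σ.apply_symm_apply a)
  comp_act_right {k n m} τ e e' h μ ν := by
    refine finsupp_ext R (F := fun μ => magComp R e μ fun i => magAct R (τ i) (ν i))
      (G := fun μ => magComp R e' μ ν)
      ⟨by intros; simp, by intros; simp⟩ ⟨by intros; simp, by intros; simp⟩ (fun t => ?_) μ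
    refine multi_ext
      (F := fun ν => magComp R e (Finsupp.single t 1) fun i => magAct R (τ i) (ν i))
      (fun ν i => ?_) (magComp_isLinear R _ _) (fun s => ?_) ν
    · have hu : ∀ x, (fun j => magAct R (τ j) (update ν i x j)) =
          update (fun j => magAct R (τ j) (ν j)) i (magAct R (τ i) x) := fun x => by
        funext j
        exact apply_update (fun j x => magAct R (τ j) x) ν i x j
      simp only [hu]
      exact (((magComp R e _).toLinearMap _ i).comp (magAct R (τ i))).isLinear
    simp only [magAct_single, magComp_single]
    congr 1
    refine Subtype.ext ?_
    simp only [TreeMonomial.relabel, TreeMonomial.graft, BinTree.map, BinTree.bind_bind,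
      BinTree.bind, ← h, Equiv.apply_symm_apply]
  one_comp {n} e h ν := by
    refine finsupp_ext R (F := fun ν => magComp R e (Finsupp.single TreeMonomial.unit 1)
      (fun _ => ν)) (?_ : IsLinearMap R _) LinearMap.id.isLinear (fun t => ?_) ν
    · have hu : ∀ x : TreeMonomial n →₀ R, (fun _ : Fin 1 => x) = update (fun _ => 0) 0 x := by
        intro x
        funext i
        rw [Subsingleton.elim i 0, update_self]
      have hF : (fun x : TreeMonomial n →₀ R =>
          magComp R e (Finsupp.single TreeMonomial.unit 1) (fun _ => x)) = fun x =>
          magComp R e (Finsupp.single TreeMonomial.unit 1) (update (fun _ => 0) 0 x) :=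
        funext fun x => congrArg _ (hu x)
      rw [hF]
      exact magComp_isLinear R e _ (fun _ => 0) 0
    rw [magComp_single R e _ fun _ => t]
    change _ = Finsupp.single t 1
    congr 1
    refine Subtype.ext ?_
    simp only [TreeMonomial.unit, TreeMonomial.graft, BinTree.bind, h]
    exact BinTree.bind_leaf _
  comp_one {n} e h μ := by
    refine finsupp_ext R (F := fun μ => magComp R e μ fun _ => Finsupp.single TreeMonomial.unit 1)
      ⟨by intros; simp, by intros; simp⟩ LinearMap.id.isLinear (fun t => ?_) μ
    rw [magComp_single R e _ fun _ => TreeMonomial.unit]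
    change _ = Finsupp.single t 1
    congr 1
    refine Subtype.ext ?_
    simp only [TreeMonomial.unit, TreeMonomial.graft, BinTree.bind, BinTree.map, h]
    exact BinTree.bind_leaf _
  assoc {k n N m l p} e e' f g h μ ν ξ := by
    refine finsupp_ext R (F := fun μ => magComp R e' (magComp R e μ ν) ξ)
      (G := fun μ => magComp R g μ fun i => magComp R (f i) (ν i) fun j => ξ (e ⟨i, j⟩))
      ⟨by intros; simp, by intros; simp⟩ ⟨by intros; simp, by intros; simp⟩ (fun t => ?_) μ
    refine multi_ext (F := fun ν => magComp R e' (magComp R e (Finsupp.single t 1) ν) ξ)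
      (G := fun ν => magComp R g (Finsupp.single t 1)
        fun i => magComp R (f i) (ν i) fun j => ξ (e ⟨i, j⟩))
      (fun ν i => ?_) (fun ν i => ?_) (fun s => ?_) ν
    · exact ⟨by intros; simp, by intros; simp⟩
    · have hu : ∀ x, (fun j => magComp R (f j) (update ν i x j) fun j' => ξ (e ⟨j, j'⟩)) =
          update (fun j => magComp R (f j) (ν j) fun j' => ξ (e ⟨j, j'⟩)) i
            (magComp R (f i) x fun j' => ξ (e ⟨i, j'⟩)) := fun x => by
        funext j
        exact apply_update (fun j x => magComp R (f j) x fun j' => ξ (e ⟨j, j'⟩)) ν i x j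
      simp only [hu]
      exact ⟨by intros; simp, by intros; simp⟩
    refine multi_ext (G := fun ξ => magComp R g (Finsupp.single t 1)
        fun i => magComp R (f i) (Finsupp.single (s i) 1) fun j => ξ (e ⟨i, j⟩))
      (magComp_isLinear R _ _) (fun ξ a => ?_) (fun r => ?_) ξ
    · obtain ⟨⟨i, j⟩, rfl⟩ := e.surjective a
      have hu := update_sigma e (fun i => magComp R (f i) (Finsupp.single (s i) 1)) ξ i j
      simp only [hu]
      exact ⟨by intros; simp, by intros; simp⟩
    have h1 : ∀ i, magComp R (f i) (Finsupp.single (s i) 1)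
        (fun j => Finsupp.single (r (e ⟨i, j⟩)) 1) =
        Finsupp.single (TreeMonomial.graft (f i) (s i) fun j => r (e ⟨i, j⟩)) 1 :=
      fun i => magComp_single R (f i) (s i) fun j => r (e ⟨i, j⟩)
    simp only [h1, magComp_single]
    congr 1
    refine Subtype.ext ?_
    simp only [TreeMonomial.graft, BinTree.map, BinTree.bind_bind, BinTree.bind, h]

end Magmatic

end Operad

section Level

variable (R : Type) [CommRing R]

/-- The basis element of the magmatic operad given by a tree monomial. -/
noncomputable def magTree {n : ℕ} (t : TreeMonomial n) : (Operad.mag R).obj n :=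
  Finsupp.single t (1 : R)

/-- The numbering of the inputs of `μ(ν₁, ν₂)` from left to right, for `μ`, `ν₁`, `ν₂` of
arity two: `⟨i, j⟩` is sent to `j + 2 * i`. -/
def fourEquiv : (Σ _ : Fin 2, Fin 2) ≃ Fin 4 :=
  (Equiv.sigmaEquivProd (Fin 2) (Fin 2)).trans finProdFinEquiv

/-- The relations of the operad of level algebras, for the generator `⋆`:
`⋆ = ⋆ (1 2)` and `⋆(⋆, ⋆) = ⋆(⋆, ⋆) (2 3)` (here the inputs are numbered from `0`). -/
inductive LevRel : ∀ n, (Operad.mag R).obj n → Prop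
  | comm : LevRel 2 (magTree R TreeMonomial.corolla -
      (Operad.mag R).act (magTree R TreeMonomial.corolla) (Equiv.swap 0 1))
  | level : LevRel 4
      ((Operad.mag R).comp fourEquiv (magTree R TreeMonomial.corolla)
          (fun _ => magTree R TreeMonomial.corolla) -
        (Operad.mag R).act
          ((Operad.mag R).comp fourEquiv (magTree R TreeMonomial.corolla)
            (fun _ => magTree R TreeMonomial.corolla)) (Equiv.swap 1 2))

/-- The operadic ideal of relations of the operad of level algebras. -/
noncomputable def levIdeal : Operad.OpIdeal (Operad.mag R) :=
  Operad.OpIdeal.generate (Operad.mag R) fun n => {x | LevRel R n x}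

/-- The operad `Lev` of level algebras. -/
noncomputable def Lev : Operad R := (Operad.mag R).quotient (levIdeal R)

/-- The element of `Lev` which is the composite of copies of the generator along the tree `t`. -/
noncomputable def levTree {n : ℕ} (t : TreeMonomial n) : (Lev R).obj n :=
  ((Operad.mag R).proj (levIdeal R)).app n (magTree R t)

/-- The generator of `Lev`. -/
noncomputable def levStar : (Lev R).obj 2 := levTree R TreeMonomial.corolla

/-- The operadic ideal of `Lev` spanned by the composites of copies of the generator along trees
of height greater than `q`. -/
noncomputable def truncIdeal (q : ℕ) : Operad.OpIdeal (Lev R) :=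
  Operad.OpIdeal.generate (Lev R) fun _ => {x | ∃ t, q < t.1.height ∧ x = levTree R t}

/-- The truncation `T_q Lev`. -/
noncomputable def TLev (q : ℕ) : Operad R := (Lev R).quotient (truncIdeal R q)

/-- The projection `Lev → T_q Lev`. -/
noncomputable def TLev.proj (q : ℕ) : Operad.Hom (Lev R) (TLev R q) :=
  (Lev R).proj (truncIdeal R q)

end Level

section Com

variable (R : Type) [CommRing R]

/-- The module `Com(n)`: it is `R` for `n > 0`, and `0` for `n = 0`. -/
def comObj (n : ℕ) : Submodule R R := if n = 0 then ⊥ else ⊤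

/-- The `n`-fold product, in `Com(n)` (it is zero for `n = 0`). -/
def comProd (n : ℕ) : comObj R n := ⟨if n = 0 then 0 else 1, by by_cases h : n = 0 <;> simp [h, comObj]⟩

lemma comProd_coe {n : ℕ} (h : 0 < n) : (comProd R n : R) = 1 := by
  simp [comProd, h.ne']

lemma comObj_zero {n : ℕ} (h : n = 0) (c : comObj R n) : c = 0 := by
  obtain ⟨c, hc⟩ := c
  refine Subtype.ext ?_
  simpa [comObj, h] using hc

lemma comObj_smul_prod {n : ℕ} (c : comObj R n) : (c : R) • comProd R n = c := by
  rcases Nat.eq_zero_or_pos n with h | h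
  · rw [comObj_zero R h c]
    simp
  · exact Subtype.ext (by simp [comProd_coe R h])

end Com

/-- A commutative algebra `A` with an element `d` such that morphisms of commutative algebras out
of `A` are determined by the image of `d`, and such that there are algebra morphisms
`A → A ⊗ ⋯ ⊗ A` sending `d` to `d ⊗ ⋯ ⊗ d`, with any positive number of factors. These morphisms
are unique. Since `d ^ n` is sent to `d ^ n ⊗ ⋯ ⊗ d ^ n`, they give the distributive law
`(d ^ n; μ) ↦ (μ; d ^ n, …, d ^ n)`. -/
class DiagonalAlgebra (R : Type) [CommRing R] (A : Type) [CommRing A] [Algebra R A] where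
  d : A
  diag : ∀ n : ℕ, 0 < n → (A →ₐ[R] ⨂[R] _ : Fin n, A)
  diag_d : ∀ (n : ℕ) (h : 0 < n), diag n h d = PiTensorProduct.tprod R fun _ => d
  hom_ext : ∀ {B : Type} [CommRing B] [Algebra R B] (f g : A →ₐ[R] B), f d = g d → f = g

namespace DiagonalAlgebra

variable (R : Type) [CommRing R]

open Polynomial in
/-- `D = R[d]`. -/
noncomputable instance polynomial : DiagonalAlgebra R R[X] where
  d := X
  diag n _ := aeval (PiTensorProduct.tprod R fun _ => X)
  diag_d n h := by simp
  hom_ext f g h := Polynomial.algHom_ext h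

lemma tprod_const_pow {A : Type} [CommRing A] [Algebra R A] (n : ℕ) (a : A) (q : ℕ) :
    (PiTensorProduct.tprod R fun _ : Fin n => a) ^ q =
      PiTensorProduct.tprod R fun _ : Fin n => a ^ q :=
  (map_pow (PiTensorProduct.tprodMonoidHom R (A := fun _ : Fin n => A)) (fun _ => a) q).symm

open LaurentPolynomial in
/-- `D^± = R[d, d⁻¹]`. -/
noncomputable instance laurent : DiagonalAlgebra R R[T;T⁻¹] where
  d := T 1
  diag n _ := AddMonoidAlgebra.lift R _ ℤ
    { toFun := fun z => PiTensorProduct.tprod R fun _ => T z.toAdd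
      map_one' := rfl
      map_mul' := fun y z => by
        rw [PiTensorProduct.tprod_mul_tprod]
        congr 1
        funext _
        exact T_add _ _ }
  diag_d n h := by
    refine (AddMonoidAlgebra.lift_single _ _ _).trans ?_
    rw [one_smul]
    rfl
  hom_ext {B} _ _ f g h := by
    have key : (f : R[T;T⁻¹] →* B).comp (AddMonoidAlgebra.of R ℤ) =
        (g : R[T;T⁻¹] →* B).comp (AddMonoidAlgebra.of R ℤ) := MonoidHom.ext_mint h
    exact AddMonoidAlgebra.algHom_ext' key (by ext)

/-- The algebra `R[d] / (d ^ (q + 1))`. -/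
abbrev TruncPoly (q : ℕ) : Type :=
  Polynomial R ⧸ Ideal.span {(Polynomial.X : Polynomial R) ^ (q + 1)}

open Polynomial in
/-- `T_q D = R[d] / (d ^ (q + 1))`. -/
noncomputable instance truncated (q : ℕ) : DiagonalAlgebra R (TruncPoly R q) where
  d := Ideal.Quotient.mk _ X
  diag n hn := Ideal.Quotient.liftₐ _
    (aeval (PiTensorProduct.tprod R fun _ => Ideal.Quotient.mk _ X)) (by
      intro a ha
      obtain ⟨b, rfl⟩ := Ideal.mem_span_singleton.1 ha
      have h0 : (Ideal.Quotient.mk (Ideal.span {(X : R[X]) ^ (q + 1)}) X) ^ (q + 1) = 0 := by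
        rw [← map_pow, Ideal.Quotient.eq_zero_iff_mem]
        exact Ideal.mem_span_singleton_self _
      rw [map_mul, map_pow, aeval_X, tprod_const_pow, h0,
        (PiTensorProduct.tprod R).map_coord_zero ⟨0, hn⟩ rfl, zero_mul])
  diag_d n h := by
    refine (Ideal.Quotient.liftₐ_apply _ _ _ _).trans ?_
    exact aeval_X _
  hom_ext f g h := Ideal.Quotient.algHom_ext _ (Polynomial.algHom_ext h)

end DiagonalAlgebra

section ComComp

variable (R : Type) [CommRing R] (A : Type) [CommRing A] [Algebra R A]

/-- The tensor power `A ⊗ ⋯ ⊗ A` with `n` factors. -/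
abbrev TPow (n : ℕ) : Type := ⨂[R] _ : Fin n, A

namespace TPow

variable {A}

/-- The algebra morphism out of a tensor power with given restrictions to the factors:
`a₁ ⊗ ⋯ ⊗ a_n` is sent to `f₁(a₁) ⋯ f_n(a_n)`. -/
noncomputable def liftHom {n : ℕ} {B : Type} [CommRing B] [Algebra R B]
    (f : Fin n → A →ₐ[R] B) : TPow R A n →ₐ[R] B :=
  PiTensorProduct.liftAlgHom
    ((MultilinearMap.mkPiAlgebra R (Fin n) B).compLinearMap fun i => (f i).toLinearMap)
    (by simp) (by intro x y; simp [Finset.prod_mul_distrib])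

lemma liftHom_tprod {n : ℕ} {B : Type} [CommRing B] [Algebra R B]
    (f : Fin n → A →ₐ[R] B) (a : Fin n → A) :
    liftHom R f (PiTensorProduct.tprod R a) = ∏ i, f i (a i) :=
  PiTensorProduct.lift.tprod _

/-- The algebra morphism `a ↦ 1 ⊗ ⋯ ⊗ a ⊗ ⋯ ⊗ 1`, with `a` as factor `i`. -/
noncomputable def single {n : ℕ} (i : Fin n) : A →ₐ[R] TPow R A n :=
  PiTensorProduct.singleAlgHom (A := fun _ => A) i

lemma single_apply {n : ℕ} (i : Fin n) (a : A) :
    single R i a = PiTensorProduct.tprod R (Pi.mulSingle i a) := rfl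

lemma liftHom_single {n : ℕ} {B : Type} [CommRing B] [Algebra R B]
    (f : Fin n → A →ₐ[R] B) (i : Fin n) (a : A) : liftHom R f (single R i a) = f i a := by
  rw [single_apply, liftHom_tprod, Finset.prod_eq_single i]
  · rw [Pi.mulSingle_eq_same]
  · intro j _ hj
    rw [Pi.mulSingle_eq_of_ne hj, map_one]
  · simp

/-- The algebra morphism moving the factor `i` to the factor `φ i`. -/
noncomputable def slotMap {m n : ℕ} (φ : Fin m → Fin n) : TPow R A m →ₐ[R] TPow R A n :=
  liftHom R fun i => single R (φ i)

variable (A) [DiagonalAlgebra R A]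

/-- The element `1 ⊗ ⋯ ⊗ d ⊗ ⋯ ⊗ 1`, with `d` as factor `i`. -/
noncomputable def gen {n : ℕ} (i : Fin n) : TPow R A n :=
  single R i (DiagonalAlgebra.d R)

variable {A}

lemma hom_ext {n : ℕ} {B : Type} [CommRing B] [Algebra R B] {f g : TPow R A n →ₐ[R] B}
    (h : ∀ i, f (gen R A i) = g (gen R A i)) : f = g :=
  PiTensorProduct.algHom_ext fun i => DiagonalAlgebra.hom_ext _ _ (h i)

lemma slotMap_gen {m n : ℕ} (φ : Fin m → Fin n) (i : Fin m) :
    slotMap R φ (gen R A i) = gen R A (φ i) :=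
  liftHom_single R _ i _

lemma diag_eq_prod {n : ℕ} (h : 0 < n) :
    DiagonalAlgebra.diag n h (DiagonalAlgebra.d R : A) = ∏ i, gen R A i := by
  rw [DiagonalAlgebra.diag_d]
  simp only [gen, single_apply]
  rw [← PiTensorProduct.tprod_prod]
  congr 1
  exact (Finset.univ_prod_mulSingle fun _ : Fin n => (DiagonalAlgebra.d R : A)).symm

/-- For `e` as in a composition `μ(ν₁, …, ν_k)`, the algebra morphism `A^{⊗ k} → A^{⊗ n}`
distributing the element in factor `i` on the factors numbered by the inputs of `ν i`, along the
morphism `A → A ⊗ ⋯ ⊗ A` sending `d` to `d ⊗ ⋯ ⊗ d`. -/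
noncomputable def spread {k n : ℕ} {m : Fin k → ℕ} (e : (Σ i, Fin (m i)) ≃ Fin n)
    (h : ∀ i, 0 < m i) : TPow R A k →ₐ[R] TPow R A n :=
  liftHom R fun i => (slotMap R fun j => e ⟨i, j⟩).comp (DiagonalAlgebra.diag (m i) (h i))

lemma spread_gen {k n : ℕ} {m : Fin k → ℕ} (e : (Σ i, Fin (m i)) ≃ Fin n)
    (h : ∀ i, 0 < m i) (i : Fin k) :
    spread R e h (gen R A i) = ∏ j, gen R A (e ⟨i, j⟩) := by
  refine (liftHom_single R _ i _).trans ?_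
  rw [AlgHom.comp_apply, diag_eq_prod, map_prod]
  simp only [slotMap_gen]

/-- The composition on tensor powers:
`(a₁ ⊗ ⋯ ⊗ a_k)((b_{1,1} ⊗ ⋯), …, (b_{k,1} ⊗ ⋯))` is the product of the `a_i`, distributed on
the inputs `⟨i, j⟩`, and of the `b_{i,j}`. -/
noncomputable def comp {k n : ℕ} {m : Fin k → ℕ} (e : (Σ i, Fin (m i)) ≃ Fin n)
    (h : ∀ i, 0 < m i) (x : TPow R A k) (y : ∀ i, TPow R A (m i)) : TPow R A n :=
  spread R e h x * ∏ i, slotMap R (fun j => e ⟨i, j⟩) (y i)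

lemma assoc {k n N : ℕ} {m : Fin k → ℕ} {l : Fin n → ℕ} {p : Fin k → ℕ}
    (e : (Σ i, Fin (m i)) ≃ Fin n) (e' : (Σ a, Fin (l a)) ≃ Fin N)
    (f : ∀ i, (Σ j : Fin (m i), Fin (l (e ⟨i, j⟩))) ≃ Fin (p i))
    (g : (Σ i, Fin (p i)) ≃ Fin N)
    (h : ∀ i j x, g ⟨i, f i ⟨j, x⟩⟩ = e' ⟨e ⟨i, j⟩, x⟩)
    (hm : ∀ i, 0 < m i) (hl : ∀ a, 0 < l a) (hp : ∀ i, 0 < p i)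
    (μ : TPow R A k) (ν : ∀ i, TPow R A (m i)) (ξ : ∀ a, TPow R A (l a)) :
    comp R e' hl (comp R e hm μ ν) ξ =
      comp R g hp μ (fun i => comp R (f i) (fun _ => hl _) (ν i) (fun j => ξ (e ⟨i, j⟩))) := by
  have h1 : (spread R e' hl).comp (spread R e hm) = spread (A := A) R g hp := by
    refine hom_ext R fun i => ?_
    rw [AlgHom.comp_apply, spread_gen, map_prod, spread_gen, ← (f i).prod_comp, ←
      Finset.univ_sigma_univ, Finset.prod_sigma]
    simp only [spread_gen, h]
  have h2 : ∀ i, (spread R e' hl).comp (slotMap R fun j => e ⟨i, j⟩) =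
      (slotMap R fun j => g ⟨i, j⟩).comp (spread (A := A) R (f i) fun _ => hl _) := fun i => by
    refine hom_ext R fun j => ?_
    rw [AlgHom.comp_apply, AlgHom.comp_apply, slotMap_gen, spread_gen, spread_gen, map_prod]
    simp only [slotMap_gen, h]
  have h3 : ∀ i j, (slotMap R fun x => e' ⟨e ⟨i, j⟩, x⟩) =
      (slotMap R fun x => g ⟨i, x⟩).comp (slotMap (A := A) R fun x => f i ⟨j, x⟩) := fun i j => by
    refine hom_ext R fun x => ?_
    rw [AlgHom.comp_apply, slotMap_gen, slotMap_gen, slotMap_gen, h]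
  simp only [comp, map_mul, map_prod]
  rw [Finset.prod_mul_distrib, ← mul_assoc, ← e.prod_comp, ← Finset.univ_sigma_univ,
    Finset.prod_sigma, ← AlgHom.comp_apply, h1]
  simp only [← AlgHom.comp_apply, h2, h3]

lemma comp_relabel {k n : ℕ} {m : Fin k → ℕ} (e : (Σ i, Fin (m i)) ≃ Fin n)
    (σ : Equiv.Perm (Fin n)) (h : ∀ i, 0 < m i) (μ : TPow R A k) (ν : ∀ i, TPow R A (m i)) :
    slotMap R σ.symm (comp R e h μ ν) = comp R (e.trans σ.symm) h μ ν := by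
  have h1 : (slotMap R σ.symm).comp (spread R e h) = spread (A := A) R (e.trans σ.symm) h := by
    refine hom_ext R fun i => ?_
    rw [AlgHom.comp_apply, spread_gen, map_prod, spread_gen]
    simp only [slotMap_gen]
    rfl
  have h2 : ∀ i, (slotMap R σ.symm).comp (slotMap R fun j => e ⟨i, j⟩) =
      slotMap (A := A) R fun j => e.trans σ.symm ⟨i, j⟩ := fun i => by
    refine hom_ext R fun j => ?_
    rw [AlgHom.comp_apply, slotMap_gen, slotMap_gen, slotMap_gen]
    rfl
  simp only [comp, map_mul, map_prod]
  simp only [← AlgHom.comp_apply, h1, h2]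

lemma comp_act_left {k n : ℕ} {m : Fin k → ℕ} (σ : Equiv.Perm (Fin k))
    (e : (Σ i, Fin (m (σ i))) ≃ Fin n) (e' : (Σ i, Fin (m i)) ≃ Fin n)
    (he : ∀ i x, e' ⟨σ i, x⟩ = e ⟨i, x⟩) (h : ∀ i, 0 < m i)
    (μ : TPow R A k) (ν : ∀ i, TPow R A (m i)) :
    comp R e (fun i => h (σ i)) (slotMap R σ.symm μ) (fun i => ν (σ i)) = comp R e' h μ ν := by
  have h1 : (spread R e fun i => h (σ i)).comp (slotMap R σ.symm) =
      spread (A := A) R e' h := by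
    refine hom_ext R fun i => ?_
    obtain ⟨i, rfl⟩ := σ.surjective i
    rw [AlgHom.comp_apply, slotMap_gen, Equiv.symm_apply_apply, spread_gen, spread_gen]
    simp only [he]
  rw [comp, comp, ← AlgHom.comp_apply, h1,
    ← Equiv.prod_comp σ fun i => slotMap R (fun j => e' ⟨i, j⟩) (ν i)]
  simp only [he]

lemma comp_act_right {k n : ℕ} {m : Fin k → ℕ} (τ : ∀ i, Equiv.Perm (Fin (m i)))
    (e e' : (Σ i, Fin (m i)) ≃ Fin n) (he : ∀ i x, e' ⟨i, τ i x⟩ = e ⟨i, x⟩)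
    (h : ∀ i, 0 < m i) (μ : TPow R A k) (ν : ∀ i, TPow R A (m i)) :
    comp R e h μ (fun i => slotMap R (τ i).symm (ν i)) = comp R e' h μ ν := by
  have h1 : spread R e h = spread (A := A) R e' h := by
    refine hom_ext R fun i => ?_
    rw [spread_gen, spread_gen, ← Equiv.prod_comp (τ i) fun j => gen R A (e' ⟨i, j⟩)]
    simp only [he]
  have h2 : ∀ i, (slotMap R fun j => e ⟨i, j⟩).comp (slotMap R (τ i).symm) =
      slotMap (A := A) R fun j => e' ⟨i, j⟩ := fun i => by
    refine hom_ext R fun j => ?_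
    rw [AlgHom.comp_apply, slotMap_gen, slotMap_gen, slotMap_gen, ← he,
      Equiv.apply_symm_apply]
  rw [comp, comp, h1]
  simp only [← AlgHom.comp_apply, h2]

end TPow

variable {A}

/-- The canonical map `Com(n) ⊗ A^{⊗ n} → A^{⊗ n}`. -/
noncomputable def comStrip (n : ℕ) : comObj R n ⊗[R] TPow R A n →ₗ[R] TPow R A n :=
  (TensorProduct.lid R (TPow R A n)).toLinearMap.comp
    ((comObj R n).subtype.rTensor (TPow R A n))

/-- The canonical map `A^{⊗ n} → Com(n) ⊗ A^{⊗ n}`. -/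
noncomputable def comWrap (n : ℕ) : TPow R A n →ₗ[R] comObj R n ⊗[R] TPow R A n :=
  TensorProduct.mk R _ _ (comProd R n)

lemma comStrip_tmul {n : ℕ} (c : comObj R n) (t : TPow R A n) :
    comStrip R n (c ⊗ₜ t) = (c : R) • t := by
  simp [comStrip]

lemma comWrap_comStrip {n : ℕ} (x : comObj R n ⊗[R] TPow R A n) :
    comWrap R n (comStrip R n x) = x := by
  induction x using TensorProduct.induction_on with
  | zero => simp
  | tmul c t =>
    rw [comStrip_tmul, map_smul, comWrap, TensorProduct.mk_apply, TensorProduct.smul_tmul',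
      comObj_smul_prod]
  | add x y hx hy => rw [map_add, map_add, hx, hy]

lemma comStrip_comWrap {n : ℕ} (h : 0 < n) (t : TPow R A n) :
    comStrip R n (comWrap R n t) = t := by
  rw [comWrap, TensorProduct.mk_apply, comStrip_tmul, comProd_coe R h, one_smul]

lemma comTensor_zero {n : ℕ} (h : n = 0) (x : comObj R n ⊗[R] TPow R A n) : x = 0 := by
  induction x using TensorProduct.induction_on with
  | zero => rfl
  | tmul c t => rw [comObj_zero R h c, TensorProduct.zero_tmul]
  | add x y hx hy => rw [hx, hy, add_zero]

/-- The action on `Com ∘ A`: the trivial action on `Com` and the permutation of the factors of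
`A^{⊗ n}`. -/
noncomputable def comAct {n : ℕ} (σ : Equiv.Perm (Fin n)) :
    (comObj R n ⊗[R] TPow R A n) →ₗ[R] (comObj R n ⊗[R] TPow R A n) :=
  (TPow.slotMap R σ.symm).toLinearMap.lTensor (comObj R n)

lemma comAct_eq {n : ℕ} (σ : Equiv.Perm (Fin n)) (x : comObj R n ⊗[R] TPow R A n) :
    comAct R σ x = comWrap R n (TPow.slotMap R σ.symm (comStrip R n x)) := by
  induction x using TensorProduct.induction_on with
  | zero => simp
  | tmul c t =>
    rw [comStrip_tmul, map_smul, map_smul, comWrap, TensorProduct.mk_apply,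
      TensorProduct.smul_tmul', comObj_smul_prod]
    rfl
  | add x y hx hy => simp only [map_add, hx, hy]

lemma comStrip_comAct {n : ℕ} (σ : Equiv.Perm (Fin n)) (x : comObj R n ⊗[R] TPow R A n) :
    comStrip R n (comAct R σ x) = TPow.slotMap R σ.symm (comStrip R n x) := by
  rcases Nat.eq_zero_or_pos n with h | h
  · rw [comTensor_zero R h x]
    simp
  · rw [comAct_eq, comStrip_comWrap R h]

variable [DiagonalAlgebra R A]

/-- The composition of `Com ∘ A`. It is zero if one of the operations `ν i` has arity `0`, since
`Com(0) = 0`. -/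
noncomputable def comComp {k n : ℕ} {m : Fin k → ℕ} (e : (Σ i, Fin (m i)) ≃ Fin n) :
    (comObj R k ⊗[R] TPow R A k) →ₗ[R]
      MultilinearMap R (fun i => comObj R (m i) ⊗[R] TPow R A (m i))
        (comObj R n ⊗[R] TPow R A n) :=
  if h : ∀ i, 0 < m i then
    { toFun := fun x =>
        ((comWrap R n).comp (LinearMap.mulLeft R (TPow.spread R e h (comStrip R k x)))
          ).compMultilinearMap
          ((MultilinearMap.mkPiAlgebra R (Fin k) (TPow R A n)).compLinearMap fun i =>
            (TPow.slotMap R fun j => e ⟨i, j⟩).toLinearMap.comp (comStrip R (m i)))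
      map_add' := by intro x y; ext z; simp [add_mul]
      map_smul' := by intro c x; ext z; simp }
  else 0

lemma comComp_eq {k n : ℕ} {m : Fin k → ℕ} (e : (Σ i, Fin (m i)) ≃ Fin n) (h : ∀ i, 0 < m i)
    (x : comObj R k ⊗[R] TPow R A k) (y : ∀ i, comObj R (m i) ⊗[R] TPow R A (m i)) :
    comComp R e x y =
      comWrap R n (TPow.comp R e h (comStrip R k x) fun i => comStrip R (m i) (y i)) := by
  rw [comComp, dif_pos h]
  rfl

variable (A)

/-- The operad `Com ∘ A`, where the algebra `A` is seen as an operad concentrated in arity one,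
with the distributive law `(d ^ n; μ) ↦ (μ; d ^ n, …, d ^ n)`. Since `A` is concentrated in
arity one, the composite symmetric sequence is
`(Com ∘ A)(n) = Com(n) ⊗_{Σ_n} Ind_1^{Σ_n} A^{⊗ n} = Com(n) ⊗ A^{⊗ n}`. -/
noncomputable def ComOver : Operad R where
  obj n := comObj R n ⊗[R] TPow R A n
  act x σ := comAct R σ x
  one := comProd R 1 ⊗ₜ 1
  comp e := comComp R e
  act_add x y σ := map_add _ x y
  act_smul c x σ := map_smul _ c x
  act_one {n} x := by
    have h : TPow.slotMap R (1 : Equiv.Perm (Fin n)).symm = AlgHom.id R (TPow R A n) :=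
      TPow.hom_ext R fun i => TPow.slotMap_gen R _ i
    rw [comAct_eq, h, AlgHom.id_apply, comWrap_comStrip]
  act_mul {n} x σ τ := by
    have h : TPow.slotMap R (σ * τ).symm =
        (TPow.slotMap R τ.symm).comp (TPow.slotMap (A := A) R σ.symm) :=
      TPow.hom_ext R fun i => by
        rw [AlgHom.comp_apply]
        simp only [TPow.slotMap_gen]
        rfl
    rw [comAct_eq, comAct_eq R τ, comStrip_comAct, h, AlgHom.comp_apply]
  comp_relabel {k n m} e σ μ ν := by
    by_cases hm : ∀ i, 0 < m i
    · rw [comAct_eq, comComp_eq R e hm, comComp_eq R _ hm]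
      rcases Nat.eq_zero_or_pos n with hn | hn
      · exact (comTensor_zero R hn _).trans (comTensor_zero R hn _).symm
      rw [comStrip_comWrap R hn, TPow.comp_relabel]
    · rw [comComp, comComp, dif_neg hm, dif_neg hm]
      simp
  comp_act_left {k n m} σ e e' h μ ν := by
    by_cases hm : ∀ i, 0 < m i
    · rw [comComp_eq R e' hm]
      refine (comComp_eq R e (fun i => hm (σ i)) _ _).trans ?_
      rw [comStrip_comAct, TPow.comp_act_left R σ e e' h hm _ fun i => comStrip R (m i) (ν i)]
    · rw [comComp, comComp, dif_neg hm, dif_neg]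
      · rfl
      · intro h'
        exact hm fun i => by simpa using h' (σ.symm i)
  comp_act_right {k n m} τ e e' h μ ν := by
    by_cases hm : ∀ i, 0 < m i
    · rw [comComp_eq R e hm, comComp_eq R e' hm]
      simp only [comStrip_comAct]
      rw [TPow.comp_act_right R τ e e' h hm]
    · rw [comComp, comComp, dif_neg hm, dif_neg hm]
      rfl
  one_comp {n} e h ν := by
    rcases Nat.eq_zero_or_pos n with hn | hn
    · exact (comTensor_zero R hn _).trans (comTensor_zero R hn _).symm
    rw [comComp_eq R e fun _ => hn, comStrip_tmul, comProd_coe R Nat.one_pos, one_smul]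
    have h1 : TPow.slotMap R (fun j => e ⟨0, j⟩) = AlgHom.id R (TPow R A n) :=
      TPow.hom_ext R fun i => by rw [TPow.slotMap_gen, h, AlgHom.id_apply]
    rw [TPow.comp, map_one, one_mul, Fin.prod_univ_one, h1, AlgHom.id_apply, comWrap_comStrip]
  comp_one {n} e h μ := by
    rw [comComp_eq R e fun _ => Nat.one_pos, comStrip_tmul, comProd_coe R Nat.one_pos, one_smul]
    have h1 : TPow.spread R e (fun _ => Nat.one_pos) = AlgHom.id R (TPow R A n) :=
      TPow.hom_ext R fun i => by
        rw [TPow.spread_gen, Fin.prod_univ_one, h, AlgHom.id_apply]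
    rw [TPow.comp, h1, AlgHom.id_apply]
    simp only [map_one, Finset.prod_const_one, mul_one]
    rw [comWrap_comStrip]
  assoc {k n N m l p} e e' f g h μ ν ξ := by
    rcases Nat.eq_zero_or_pos k with hk | hk
    · rw [comTensor_zero R hk μ]
      simp
    by_cases hm : ∀ i, 0 < m i
    · by_cases hl : ∀ a, 0 < l a
      · have hn : 0 < n := Fin.pos (e ⟨⟨0, hk⟩, ⟨0, hm _⟩⟩)
        have hp : ∀ i, 0 < p i := fun i => Fin.pos (f i ⟨⟨0, hm i⟩, ⟨0, hl _⟩⟩)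
        rw [comComp_eq R e' hl, comComp_eq R e hm, comStrip_comWrap R hn, comComp_eq R g hp,
          TPow.assoc R e e' f g h hm hl hp]
        congr 2
        funext i
        exact ((congrArg _ (comComp_eq R (f i) (fun _ => hl _) (ν i)
          fun j => ξ (e ⟨i, j⟩))).trans (comStrip_comWrap R (hp i) _)).symm
      · push Not at hl
        obtain ⟨a, ha⟩ := hl
        obtain ⟨⟨i, j⟩, rfl⟩ := e.surjective a
        have h0 := comTensor_zero R (Nat.le_zero.1 ha) (ξ (e ⟨i, j⟩))
        rw [MultilinearMap.map_coord_zero _ (e ⟨i, j⟩) h0,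
          MultilinearMap.map_coord_zero _ i]
        exact MultilinearMap.map_coord_zero _ j h0
    · push Not at hm
      obtain ⟨i, hi⟩ := hm
      have h0 := comTensor_zero R (Nat.le_zero.1 hi) (ν i)
      rw [MultilinearMap.map_coord_zero _ i h0, map_zero, zero_apply,
        MultilinearMap.map_coord_zero _ i]
      change comComp R (f i) (ν i) _ = 0
      rw [h0]
      simp

variable {A} in
lemma comComp_tmul {k n : ℕ} {m : Fin k → ℕ} (e : (Σ i, Fin (m i)) ≃ Fin n)
    (h : ∀ i, 0 < m i) (c : comObj R k) (x : TPow R A k) (c' : ∀ i, comObj R (m i))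
    (y : ∀ i, TPow R A (m i)) :
    comComp R e (c ⊗ₜ[R] x) (fun i => c' i ⊗ₜ[R] y i) =
      (((c : R) * ∏ i, (c' i : R)) • comProd R n) ⊗ₜ[R] TPow.comp R e h x y := by
  rw [comComp_eq R e h, comStrip_tmul]
  simp only [comStrip_tmul, TPow.comp, map_smul]
  rw [Finset.prod_smul, smul_mul_smul_comm, map_smul]
  exact TensorProduct.smul_tmul' _ _ _

/-- The operation `(·; d, d)` of `Com ∘ A`, where `·` is the generator of `Com`. -/
noncomputable def comOverOp : (ComOver R A).obj 2 :=
  comProd R 2 ⊗ₜ[R] (PiTensorProduct.tprod R fun _ => DiagonalAlgebra.d R)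

end ComComp

section Functoriality

variable (R : Type) [CommRing R] {A B : Type} [CommRing A] [Algebra R A] [CommRing B] [Algebra R B]

/-- The algebra morphism `φ ⊗ ⋯ ⊗ φ`. -/
noncomputable def TPow.mapHom (φ : A →ₐ[R] B) (n : ℕ) : TPow R A n →ₐ[R] TPow R B n :=
  TPow.liftHom R fun i => (TPow.single R i).comp φ

lemma TPow.mapHom_toLinearMap (φ : A →ₐ[R] B) (n : ℕ) :
    (TPow.mapHom R φ n).toLinearMap = PiTensorProduct.map fun _ => φ.toLinearMap := by
  refine PiTensorProduct.ext (MultilinearMap.ext fun a => ?_)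
  change TPow.liftHom R _ (PiTensorProduct.tprod R a) =
    PiTensorProduct.map (fun _ => φ.toLinearMap) (PiTensorProduct.tprod R a)
  rw [TPow.liftHom_tprod, PiTensorProduct.map_tprod]
  simp only [AlgHom.comp_apply, TPow.single_apply]
  rw [← PiTensorProduct.tprod_prod]
  congr 1
  exact Finset.univ_prod_mulSingle fun i => φ (a i)

lemma comStrip_map (φ : A →ₐ[R] B) (n : ℕ) (x : comObj R n ⊗[R] TPow R A n) :
    comStrip R n ((TPow.mapHom R φ n).toLinearMap.lTensor (comObj R n) x) =
      TPow.mapHom R φ n (comStrip R n x) := by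
  induction x using TensorProduct.induction_on with
  | zero => simp
  | tmul c t =>
    rw [LinearMap.lTensor_tmul, comStrip_tmul, comStrip_tmul, map_smul]
    rfl
  | add x y hx hy => simp only [map_add, hx, hy]

lemma map_comWrap (φ : A →ₐ[R] B) (n : ℕ) (t : TPow R A n) :
    (TPow.mapHom R φ n).toLinearMap.lTensor (comObj R n) (comWrap R n t) =
      comWrap R n (TPow.mapHom R φ n t) := rfl

variable [DiagonalAlgebra R A] [DiagonalAlgebra R B]

lemma TPow.mapHom_gen (φ : A →ₐ[R] B) (hφ : φ (DiagonalAlgebra.d R) = DiagonalAlgebra.d R)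
    {n : ℕ} (i : Fin n) : TPow.mapHom R φ n (TPow.gen R A i) = TPow.gen R B i := by
  refine (TPow.liftHom_single R _ i _).trans ?_
  rw [AlgHom.comp_apply, hφ]
  rfl

lemma TPow.mapHom_comp (φ : A →ₐ[R] B) (hφ : φ (DiagonalAlgebra.d R) = DiagonalAlgebra.d R)
    {k n : ℕ} {m : Fin k → ℕ} (e : (Σ i, Fin (m i)) ≃ Fin n) (h : ∀ i, 0 < m i)
    (x : TPow R A k) (y : ∀ i, TPow R A (m i)) :
    TPow.mapHom R φ n (TPow.comp R e h x y) =
      TPow.comp R e h (TPow.mapHom R φ k x) fun i => TPow.mapHom R φ (m i) (y i) := by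
  have h1 : (TPow.mapHom R φ n).comp (TPow.spread R e h) =
      (TPow.spread R e h).comp (TPow.mapHom R φ k) := TPow.hom_ext R fun i => by
    rw [AlgHom.comp_apply, AlgHom.comp_apply, TPow.spread_gen, TPow.mapHom_gen R φ hφ,
      TPow.spread_gen, map_prod]
    simp only [TPow.mapHom_gen R φ hφ]
  have h2 : ∀ i, (TPow.mapHom R φ n).comp (TPow.slotMap R fun j => e ⟨i, j⟩) =
      (TPow.slotMap R fun j => e ⟨i, j⟩).comp (TPow.mapHom R φ (m i)) := fun i =>
    TPow.hom_ext R fun j => by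
      rw [AlgHom.comp_apply, AlgHom.comp_apply, TPow.slotMap_gen, TPow.mapHom_gen R φ hφ,
        TPow.mapHom_gen R φ hφ, TPow.slotMap_gen]
  simp only [TPow.comp, map_mul, map_prod]
  simp only [← AlgHom.comp_apply, h1, h2]

lemma map_comAct (φ : A →ₐ[R] B) (hφ : φ (DiagonalAlgebra.d R) = DiagonalAlgebra.d R)
    {n : ℕ} (x : comObj R n ⊗[R] TPow R A n) (σ : Equiv.Perm (Fin n)) :
    (TPow.mapHom R φ n).toLinearMap.lTensor (comObj R n) (comAct R σ x) =
      comAct R σ ((TPow.mapHom R φ n).toLinearMap.lTensor (comObj R n) x) := by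
  have h : (TPow.mapHom R φ n).comp (TPow.slotMap R σ.symm) =
      (TPow.slotMap R σ.symm).comp (TPow.mapHom R φ n) := TPow.hom_ext R fun j => by
    rw [AlgHom.comp_apply, AlgHom.comp_apply, TPow.slotMap_gen, TPow.mapHom_gen R φ hφ,
      TPow.mapHom_gen R φ hφ, TPow.slotMap_gen]
  rw [comAct_eq, comAct_eq, comStrip_map, map_comWrap, ← AlgHom.comp_apply, h,
    AlgHom.comp_apply]

lemma map_comComp (φ : A →ₐ[R] B) (hφ : φ (DiagonalAlgebra.d R) = DiagonalAlgebra.d R)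
    {k n : ℕ} {m : Fin k → ℕ} (e : (Σ i, Fin (m i)) ≃ Fin n)
    (μ : comObj R k ⊗[R] TPow R A k) (ν : ∀ i, comObj R (m i) ⊗[R] TPow R A (m i)) :
    (TPow.mapHom R φ n).toLinearMap.lTensor (comObj R n) (comComp R e μ ν) =
      comComp R e ((TPow.mapHom R φ k).toLinearMap.lTensor (comObj R k) μ)
        fun i => (TPow.mapHom R φ (m i)).toLinearMap.lTensor (comObj R (m i)) (ν i) := by
  by_cases hm : ∀ i, 0 < m i
  · rw [comComp_eq R e hm, comComp_eq R e hm, map_comWrap, TPow.mapHom_comp R φ hφ]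
    simp only [comStrip_map]
  · rw [comComp, comComp, dif_neg hm, dif_neg hm]
    simp

/-- The morphism of operads `Com ∘ A → Com ∘ B` induced by an algebra morphism `φ : A → B`
compatible with the elements `d`: it sends `(μ; a₁, …, a_n)` to `(μ; φ(a₁), …, φ(a_n))`. -/
noncomputable def ComOver.map (φ : A →ₐ[R] B)
    (hφ : φ (DiagonalAlgebra.d R) = DiagonalAlgebra.d R) :
    Operad.Hom (ComOver R A) (ComOver R B) where
  app n := (TPow.mapHom R φ n).toLinearMap.lTensor (comObj R n)
  map_act x σ := map_comAct R φ hφ x σ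
  map_one := by
    change (TPow.mapHom R φ 1).toLinearMap.lTensor (comObj R 1) (comProd R 1 ⊗ₜ 1) =
      comProd R 1 ⊗ₜ 1
    rw [LinearMap.lTensor_tmul, AlgHom.toLinearMap_apply, _root_.map_one]
  map_comp e μ ν := map_comComp R φ hφ e μ ν

/-- The morphism of operads `Com ∘ D → Com ∘ T_q D` induced by the projection
`R[d] → R[d] / (d ^ (q + 1))`. -/
noncomputable def ComOver.truncProj (q : ℕ) : Operad.Hom (ComOver R (Polynomial R))
    (ComOver R (DiagonalAlgebra.TruncPoly R q)) :=
  ComOver.map R (Ideal.Quotient.mkₐ R _) rfl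

end Functoriality

/-! A binary tree with labelled leaves is sent by `f` to the product decorated with `d ^ δ i` at
input `i`, where `δ i` is the depth of the leaf `i`, since each vertex above which a leaf lies
contributes one `d` to it (`comTree_eq_comPow`). So `f` sees only depths, and both defining
relations of `Lev` preserve them, which gives existence. Uniqueness holds because trees span `Lev`
and are composites of the generator (`Lev.hom_ext`).

For injectivity, the point is that `Lev` sees no more than depths: two trees whose leaves have the
same depths are equal in `Lev` (`levTree_eq_of_profile_eq`). This rests on a statement about a set
with a commutative operation satisfying `(ab)(cd) = (ac)(bd)`: the value of a tree depends only on
its leaves and their depths (`LevelEval.unique`). A nontrivial tree has two sibling leaves `x`, `y`;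
in any other tree with the same depths, the relations make `x` and `y` siblings too
(`LevelEval.merge`). Replacing the pair by the single leaf `op x y` in both trees, one concludes by
induction on the number of leaves.

Thus `Lev` is spanned by one element for each depth function, and the images of these elements are
distinct monomials in the powers of `d`, separated by products of coefficient forms. For the
truncation, the height is the largest depth, so a tree of height greater than `q` is sent to a
tensor with a factor `d ^ j`, `j > q`, which is zero, while the monomials with all exponents at most
`q` remain separated. An element with zero image is therefore a combination of trees of height
greater than `q`. The theorem `mem_span_of_levHom_eq_zero` treats all three algebras at once,
through a set `K` of exponents that can be separated. The argument works over any commutative ring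
`R`. -/

/-! ### Values of trees for a commutative operation with `(ab)(cd) = (ac)(bd)`. -/

namespace LevelEval

/-- The increase by one of the depth of a leaf. -/
def deepen {M : Type} (p : M × ℕ) : M × ℕ := (p.1, p.2 + 1)

lemma deepen_injective {M : Type} : Injective (deepen (M := M)) := by
  rintro ⟨a, i⟩ ⟨b, j⟩ h
  simpa [deepen] using h

end LevelEval

open LevelEval (deepen deepen_injective)

/-- `LevelEval op S v` says that `v` is the value, for the operation `op`, of a binary tree whose
leaves, together with their depths, are the elements of `S`. -/
inductive LevelEval {M : Type} (op : M → M → M) : Multiset (M × ℕ) → M → Prop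
  | leaf (v : M) : LevelEval op {(v, 0)} v
  | node {S S' : Multiset (M × ℕ)} {a b : M} : LevelEval op S a → LevelEval op S' b →
      LevelEval op ((S + S').map deepen) (op a b)

namespace LevelEval

variable {M : Type} {op : M → M → M}

lemma card_pos {S : Multiset (M × ℕ)} {v : M} (h : LevelEval op S v) : 0 < S.card := by
  induction h with
  | leaf v => simp
  | node _ _ h1 h2 => simp; omega

lemma of_card_eq_one {S : Multiset (M × ℕ)} {v : M} (h : LevelEval op S v) (hS : S.card = 1) :
    S = {(v, 0)} := by
  cases h with
  | leaf v => rfl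
  | node h1 h2 =>
    have := h1.card_pos
    have := h2.card_pos
    simp at hS
    omega

/-- Below a vertex every leaf has positive depth, so a leaf of depth zero is the whole tree. -/
lemma of_cons_zero {S : Multiset (M × ℕ)} {x v : M} (h : LevelEval op ((x, 0) ::ₘ S) v) :
    S = 0 ∧ v = x := by
  generalize hT : (x, 0) ::ₘ S = T at h
  cases h with
  | leaf v =>
    have h1 : S = 0 := by simpa using congrArg Multiset.card hT
    subst h1
    have h2 : x = v := by simpa using hT
    exact ⟨rfl, h2.symm⟩
  | node h1 h2 =>
    have h3 : (x, 0) ∈ (x, 0) ::ₘ S := Multiset.mem_cons_self _ _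
    rw [hT, Multiset.mem_map] at h3
    obtain ⟨p, _, hp⟩ := h3
    simp [deepen] at hp

lemma cons_eq_map_deepen {S T : Multiset (M × ℕ)} {x : M} {D : ℕ}
    (h : (x, D + 1) ::ₘ S = T.map deepen) :
    ∃ T', T = (x, D) ::ₘ T' ∧ S = T'.map deepen := by
  classical
  obtain ⟨p, hp, hpx, hS⟩ := (Multiset.map_eq_cons _ _ _ _).2 h.symm
  have h1 : p = (x, D) := deepen_injective hpx
  subst h1
  exact ⟨T.erase (x, D), (Multiset.cons_erase hp).symm, hS.symm⟩

lemma cons_eq_add {β : Type} {T S1 S2 : Multiset β} {x : β} (h : S1 + S2 = x ::ₘ T) :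
    (∃ S, S1 = x ::ₘ S ∧ T = S + S2) ∨ ∃ S, S2 = x ::ₘ S ∧ T = S1 + S := by
  have hx : x ∈ S1 + S2 := h ▸ Multiset.mem_cons_self _ _
  rcases Multiset.mem_add.1 hx with hx | hx
  · obtain ⟨S, rfl⟩ := Multiset.exists_cons_of_mem hx
    exact Or.inl ⟨S, rfl, by simpa using h.symm⟩
  · obtain ⟨S, rfl⟩ := Multiset.exists_cons_of_mem hx
    exact Or.inr ⟨S, rfl, by simpa using h.symm⟩

/-- A leaf of positive depth lies in one of the two subtrees at the root; commutativity allows this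
subtree to be called the first one. -/
lemma of_cons_succ (comm : ∀ a b, op a b = op b a) {S : Multiset (M × ℕ)} {x v : M} {D : ℕ}
    (h : LevelEval op ((x, D + 1) ::ₘ S) v) :
    ∃ S1 S2 a b, LevelEval op ((x, D) ::ₘ S1) a ∧ LevelEval op S2 b ∧ v = op a b ∧
      S = (S1 + S2).map deepen := by
  generalize hT : (x, D + 1) ::ₘ S = T at h
  cases h with
  | leaf v =>
    have h3 : (x, D + 1) ∈ (x, D + 1) ::ₘ S := Multiset.mem_cons_self _ _
    rw [hT] at h3
    simp at h3
  | @node S1 S2 a b h1 h2 =>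
    obtain ⟨T', hT', rfl⟩ := cons_eq_map_deepen hT
    rcases cons_eq_add hT' with ⟨U, rfl, rfl⟩ | ⟨U, rfl, rfl⟩
    · exact ⟨U, S2, a, b, h1, h2, rfl, rfl⟩
    · exact ⟨U, S1, b, a, h2, h1, comm a b, by rw [add_comm]⟩

/-- In a tree with two leaves `x` and `y` of the same depth, one may assume that these leaves are
attached to the same vertex, which is then replaced by its value. -/
lemma merge (comm : ∀ a b, op a b = op b a)
    (level : ∀ a b c d, op (op a b) (op c d) = op (op a c) (op b d)) {D : ℕ} :
    ∀ {S : Multiset (M × ℕ)} {x y v : M},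
      LevelEval op ((x, D + 1) ::ₘ (y, D + 1) ::ₘ S) v →
      LevelEval op ((op x y, D) ::ₘ S) v := by
  induction D with
  | zero =>
    intro S x y v h
    obtain ⟨S1, S2, a, b, ha, hb, rfl, hS⟩ := of_cons_succ comm h
    -- Each of the two leaves has depth zero in its subtree, hence is that subtree, and the tree is
    -- just `op x y`.
    obtain ⟨rfl, rfl⟩ := of_cons_zero ha
    obtain ⟨T', hT', rfl⟩ := cons_eq_map_deepen hS
    rw [zero_add] at hT'
    subst hT'
    obtain ⟨rfl, rfl⟩ := of_cons_zero hb
    exact leaf _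
  | succ D ih =>
    intro S x y v h
    obtain ⟨S1, S2, a, b, ha, hb, rfl, hS⟩ := of_cons_succ comm h
    obtain ⟨T', hT', rfl⟩ := cons_eq_map_deepen hS
    rcases cons_eq_add hT' with ⟨U, rfl, rfl⟩ | ⟨U, rfl, rfl⟩
    · simpa [deepen] using (ih ha).node hb
    -- The leaves lie in different subtrees `a = a1 a2` and `b = b1 b2`, with `x` in `a1` and `y` in
    -- `b1`. The level relation turns `(a1 a2)(b1 b2)` into `(a1 b1)(a2 b2)`, where both leaves lie
    -- in `a1 b1`, at depth `D + 1`, and the induction hypothesis applies to that subtree.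
    · obtain ⟨U1, U2, a1, a2, h1, h2, rfl, rfl⟩ := of_cons_succ comm ha
      obtain ⟨W1, W2, b1, b2, h3, h4, rfl, rfl⟩ := of_cons_succ comm hb
      rw [level]
      have h5 : LevelEval op ((x, D + 1) ::ₘ (y, D + 1) ::ₘ (U1 + W1).map deepen) (op a1 b1) := by
        rw [Multiset.cons_swap]
        simpa [deepen] using h1.node h3
      have h6 := (ih h5).node (h2.node h4)
      have h7 : (U1 + W1).map deepen + (U2 + W2).map deepen =
          (U1 + U2).map deepen + (W1 + W2).map deepen := by
        simp only [Multiset.map_add]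
        exact add_add_add_comm _ _ _ _
      rw [Multiset.cons_add, Multiset.map_cons, h7] at h6
      exact h6

/-- A tree which is not a leaf has two leaves attached to the same vertex, which may be replaced
by its value. -/
lemma exists_siblings {S : Multiset (M × ℕ)} {v : M} (h : LevelEval op S v) (hS : 1 < S.card) :
    ∃ D x y S', S = (x, D + 1) ::ₘ (y, D + 1) ::ₘ S' ∧ LevelEval op ((op x y, D) ::ₘ S') v := by
  induction h with
  | leaf v => simp at hS
  | @node S1 S2 a b h1 h2 ih1 ih2 =>
    by_cases hc1 : 1 < S1.card
    · obtain ⟨D, x, y, S', rfl, h⟩ := ih1 hc1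
      exact ⟨D + 1, x, y, (S' + S2).map deepen, by simp [deepen],
        by simpa [deepen] using h.node h2⟩
    by_cases hc2 : 1 < S2.card
    · obtain ⟨D, x, y, S', rfl, h⟩ := ih2 hc2
      exact ⟨D + 1, x, y, (S1 + S').map deepen, by simp [deepen],
        by simpa [deepen] using h1.node h⟩
    · obtain rfl := h1.of_card_eq_one (by have := h1.card_pos; omega)
      obtain rfl := h2.of_card_eq_one (by have := h2.card_pos; omega)
      exact ⟨0, a, b, 0, by simp [deepen], leaf _⟩

/-- The value of a tree in a level algebra depends only on its leaves and on their depths. -/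
theorem unique (comm : ∀ a b, op a b = op b a)
    (level : ∀ a b c d, op (op a b) (op c d) = op (op a c) (op b d)) {S : Multiset (M × ℕ)}
    {v w : M} (hv : LevelEval op S v) (hw : LevelEval op S w) : v = w := by
  induction hn : S.card generalizing S with
  | zero =>
    have := hv.card_pos
    omega
  | succ n ih =>
    rcases Nat.eq_zero_or_pos n with rfl | hpos
    · have h1 := hv.of_card_eq_one hn
      rw [hw.of_card_eq_one hn] at h1
      simpa using h1.symm
    -- A pair of siblings of the first tree is merged in the second tree as well. Leaves being
    -- arbitrary elements of `M`, the value `op x y` serves as a new leaf, and both trees lose one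
    -- leaf.
    · obtain ⟨D, x, y, S', rfl, h⟩ := hv.exists_siblings (by omega)
      exact ih h (merge comm level hw) (by simpa using hn)

end LevelEval

/-! ### Depth profiles of trees. -/

namespace BinTree

variable {α β : Type}

/-- The labels of the leaves together with their depths, with multiplicity. -/
def profile : BinTree α → Multiset (α × ℕ)
  | leaf a => {(a, 0)}
  | node s t => (s.profile + t.profile).map deepen

lemma profile_map_fst (t : BinTree α) : t.profile.map Prod.fst = t.leaves := by
  induction t with
  | leaf a => rfl
  | node s t hs ht =>
    rw [profile, leaves, Multiset.map_map, ← hs, ← ht, ← Multiset.map_add]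
    rfl

lemma exists_mem_profile_height (t : BinTree α) : ∃ a, (a, t.height) ∈ t.profile := by
  induction t with
  | leaf a => exact ⟨a, Multiset.mem_singleton_self _⟩
  | node s t hs ht =>
    obtain ⟨a, ha⟩ := hs
    obtain ⟨b, hb⟩ := ht
    rcases le_total s.height t.height with h | h
    · exact ⟨b, Multiset.mem_map.2 ⟨(b, t.height), Multiset.mem_add.2 (Or.inr hb),
        by simp [deepen, height, h]⟩⟩
    · exact ⟨a, Multiset.mem_map.2 ⟨(a, s.height), Multiset.mem_add.2 (Or.inl ha),
        by simp [deepen, height, h]⟩⟩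

lemma le_height_of_mem_profile {t : BinTree α} {p : α × ℕ} (h : p ∈ t.profile) :
    p.2 ≤ t.height := by
  induction t generalizing p with
  | leaf a =>
    obtain rfl := Multiset.mem_singleton.1 h
    exact le_rfl
  | node s t hs ht =>
    obtain ⟨p, hp, rfl⟩ := Multiset.mem_map.1 h
    rcases Multiset.mem_add.1 hp with hp | hp
    · exact Nat.succ_le_succ ((hs hp).trans (le_max_left _ _))
    · exact Nat.succ_le_succ ((ht hp).trans (le_max_right _ _))

/-- This brings trees with labels under `LevelEval.unique`; it is used with `F` the class of a tree
modulo the relations of `Lev`. -/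
lemma levelEval {M : Type} {op : M → M → M} (F : BinTree α → M)
    (hF : ∀ s t, F (node s t) = op (F s) (F t)) (t : BinTree α) :
    LevelEval op (t.profile.map (Prod.map (fun a => F (leaf a)) id)) (F t) := by
  induction t with
  | leaf a => exact .leaf _
  | node s t hs ht =>
    rw [hF]
    convert hs.node ht using 1
    rw [profile, ← Multiset.map_add, Multiset.map_map, Multiset.map_map]
    rfl

lemma map_map {γ : Type} (t : BinTree α) (f : α → β) (g : β → γ) :
    (t.map f).map g = t.map fun a => g (f a) :=
  bind_bind t _ _

lemma map_bind {γ : Type} (t : BinTree α) (f : α → BinTree β) (g : β → γ) :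
    (t.bind f).map g = t.bind fun a => (f a).map g :=
  bind_bind t _ _

end BinTree

/-! ### Trees with arbitrary labels as relabelled tree monomials. -/

namespace BinTree

variable {α β : Type}

lemma map_injective {f : α → β} (hf : Injective f) : Injective (map f) := by
  intro s
  induction s with
  | leaf a =>
    rintro (b | ⟨_, _⟩) h
    · exact congrArg leaf (hf (leaf.inj h))
    · cases h
  | node s t hs ht =>
    rintro (_ | ⟨s', t'⟩) h
    · cases h
    · have h1 := node.inj h
      rw [hs h1.1, ht h1.2]

end BinTree

namespace TreeMonomial

variable {α : Type}

lemma map_graft {k n : ℕ} {m : Fin k → ℕ} (e : (Σ i, Fin (m i)) ≃ Fin n) (t : TreeMonomial k)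
    (s : ∀ i, TreeMonomial (m i)) (F : Fin n → α) :
    (t.graft e s).1.map F = t.1.bind fun i => (s i).1.map fun j => F (e ⟨i, j⟩) := by
  simp only [graft, BinTree.map_bind, BinTree.map_map]

lemma leaves_map {n : ℕ} (u : TreeMonomial n) (φ : Fin n → α) :
    (u.1.map φ).leaves = Finset.univ.val.map φ := by
  rw [BinTree.leaves_map, u.2]

end TreeMonomial

/-- Gathers the labellings of the trees to be grafted into one labelling of the grafted tree. -/
lemma exists_finSigma_desc {α : Type} {k : ℕ} {m : Fin k → ℕ} (φ : ∀ i, Fin (m i) → α) :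
    ∃ F : Fin (∑ i, m i) → α, ∀ i j, F (finSigmaFinEquiv ⟨i, j⟩) = φ i j :=
  ⟨fun x => (fun p : Σ i, Fin (m i) => φ p.1 p.2) (finSigmaFinEquiv.symm x),
    fun i j => congrArg (fun p : Σ i, Fin (m i) => φ p.1 p.2)
      (finSigmaFinEquiv.symm_apply_apply ⟨i, j⟩)⟩

/-- The common multiset of values has no repetition, so `ψ` is injective too, and each value
determines one index on either side. -/
lemma exists_perm_of_map_univ_eq {α : Type} {m n : ℕ} {ψ : Fin m → α} {φ : Fin n → α}
    (h : (Finset.univ : Finset (Fin m)).val.map ψ = (Finset.univ : Finset (Fin n)).val.map φ)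
    (hφ : Injective φ) : ∃ σ : Fin m ≃ Fin n, ψ = φ ∘ σ := by
  have hψ : Injective ψ := by
    rw [← Fintype.nodup_map_univ_iff_injective, h]
    exact Fintype.nodup_map_univ_iff_injective.2 hφ
  have h1 : ∀ i, ∃ j, φ j = ψ i := fun i => by
    have h2 := Multiset.mem_map_of_mem ψ (Finset.mem_univ_val i)
    rw [h, Multiset.mem_map] at h2
    exact h2.imp fun j hj => hj.2
  choose σ hσ using h1
  have hinj : Injective σ := fun i j hij => hψ (by rw [← hσ, ← hσ, hij])
  have hcard : m = n := by simpa using congrArg Multiset.card h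
  exact ⟨Equiv.ofBijective σ ((Fintype.bijective_iff_injective_and_card σ).2
    ⟨hinj, by simpa using hcard⟩), funext fun i => (hσ i).symm⟩

namespace TreeMonomial

lemma bijective_of_map_eq {m n : ℕ} {u : TreeMonomial m} {φ : Fin m → Fin n} {t : TreeMonomial n}
    (h : u.1.map φ = t.1) : m = n ∧ Bijective φ := by
  have h1 : (Finset.univ : Finset (Fin m)).val.map φ =
      (Finset.univ : Finset (Fin n)).val.map id := by
    rw [← leaves_map u, h, t.2, Multiset.map_id]
  obtain ⟨σ, rfl⟩ := exists_perm_of_map_univ_eq h1 injective_id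
  exact ⟨Fin.equiv_iff_eq.1 ⟨σ⟩, σ.bijective⟩

end TreeMonomial

namespace Operad

variable {R : Type} [CommRing R]

lemma OpIdeal.subset_generate (P : Operad R) (S : ∀ n, Set (P.obj n)) {n : ℕ} {x : P.obj n}
    (hx : x ∈ S n) : x ∈ (OpIdeal.generate P S).carrier n := by
  simp only [OpIdeal.generate, Submodule.mem_iInf]
  exact fun J hJ => hJ n hx

lemma OpIdeal.generate_le {P : Operad R} {S : ∀ n, Set (P.obj n)} (J : OpIdeal P)
    (hJ : ∀ n, S n ⊆ J.carrier n) (n : ℕ) : (OpIdeal.generate P S).carrier n ≤ J.carrier n := by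
  intro x hx
  simp only [OpIdeal.generate, Submodule.mem_iInf] at hx
  exact hx J hJ

end Operad

/-! ### Trees modulo the relations of level algebras. -/

section LevTree

variable (R : Type) [CommRing R]

lemma levTree_graft {k n : ℕ} {m : Fin k → ℕ} (e : (Σ i, Fin (m i)) ≃ Fin n)
    (t : TreeMonomial k) (s : ∀ i, TreeMonomial (m i)) :
    levTree R (t.graft e s) = (Lev R).comp e (levTree R t) fun i => levTree R (s i) := by
  rw [levTree, magTree, ← Operad.magComp_single]
  exact ((Operad.mag R).proj (levIdeal R)).map_comp e (magTree R t) fun i => magTree R (s i)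

lemma levTree_relabel {n : ℕ} (σ : Equiv.Perm (Fin n)) (t : TreeMonomial n) :
    levTree R (t.relabel σ) = (Lev R).act (levTree R t) σ.symm := by
  have h := ((Operad.mag R).proj (levIdeal R)).map_act (magTree R t) σ.symm
  refine Eq.trans ?_ h
  exact congrArg _ (Operad.magAct_single R σ.symm t).symm

lemma levTree_unit : levTree R TreeMonomial.unit = (Lev R).one := rfl

lemma levTree_eq_of_sub_mem {n : ℕ} {s t : TreeMonomial n}
    (h : magTree R s - magTree R t ∈ (levIdeal R).carrier n) : levTree R s = levTree R t :=
  (Submodule.Quotient.eq _).2 h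

lemma levTree_corolla_swap :
    levTree R TreeMonomial.corolla = levTree R (TreeMonomial.corolla.relabel (Equiv.swap 0 1)) := by
  refine levTree_eq_of_sub_mem R (Operad.OpIdeal.subset_generate _ _ ?_)
  have h := LevRel.comm (R := R)
  have h1 := Operad.magAct_single R (Equiv.swap 0 1) TreeMonomial.corolla
  rw [Equiv.symm_swap] at h1
  change LevRel R 2 _
  convert h using 2
  exact h1.symm

lemma levTree_level :
    levTree R (TreeMonomial.corolla.graft fourEquiv fun _ => TreeMonomial.corolla) =
      levTree R ((TreeMonomial.corolla.graft fourEquiv fun _ => TreeMonomial.corolla).relabel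
        (Equiv.swap 1 2)) := by
  refine levTree_eq_of_sub_mem R (Operad.OpIdeal.subset_generate _ _ ?_)
  have h := LevRel.level (R := R)
  have h1 := Operad.magAct_single R (Equiv.swap 1 2)
    (TreeMonomial.corolla.graft fourEquiv fun _ => TreeMonomial.corolla)
  have h2 := Operad.magComp_single R fourEquiv TreeMonomial.corolla fun _ => TreeMonomial.corolla
  rw [Equiv.symm_swap] at h1
  have h3 : (Operad.mag R).comp fourEquiv (magTree R TreeMonomial.corolla)
      (fun _ => magTree R TreeMonomial.corolla) = magTree R
        (TreeMonomial.corolla.graft fourEquiv fun _ => TreeMonomial.corolla) := h2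
  rw [h3] at h
  have h4 : (Operad.mag R).act (magTree R
        (TreeMonomial.corolla.graft fourEquiv fun _ => TreeMonomial.corolla)) (Equiv.swap 1 2) =
      magTree R ((TreeMonomial.corolla.graft fourEquiv fun _ => TreeMonomial.corolla).relabel
        (Equiv.swap 1 2)) := h1
  rw [h4] at h
  exact h

variable {α : Type}

/-- Trees with the same leaves which, if these are distinct, have the same class in `Lev`. -/
def LevEq (t t' : BinTree α) : Prop :=
  t.leaves = t'.leaves ∧ (t.leaves.Nodup → ∃ (n : ℕ) (u u' : TreeMonomial n) (φ : Fin n → α),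
    u.1.map φ = t ∧ u'.1.map φ = t' ∧ levTree R u = levTree R u')

namespace LevEq

variable {R}

/-- Absence of repeated labels in the grafted tree passes to each `s i`, which provides
representatives; these are grafted, and the class in `Lev` is compatible with grafting. Taking `T`
and `T'` to be the two sides of a relation of `Lev` gives this relation for arbitrary subtrees. -/
lemma bind {k : ℕ} {T T' : TreeMonomial k} (hT : levTree R T = levTree R T')
    {s s' : Fin k → BinTree α} (h : ∀ i, LevEq R (s i) (s' i)) :
    LevEq R (T.1.bind s) (T'.1.bind s') := by
  refine ⟨?_, fun hn => ?_⟩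
  · rw [BinTree.leaves_bind, BinTree.leaves_bind, T.2, T'.2]
    simp only [fun i => (h i).1]
  · rw [BinTree.leaves_bind, T.2, Multiset.nodup_bind] at hn
    choose m u u' φ hu hu' he using fun i => (h i).2 (hn.1 i (Finset.mem_univ i))
    obtain ⟨F, hF⟩ := exists_finSigma_desc φ
    refine ⟨_, T.graft finSigmaFinEquiv u, T'.graft finSigmaFinEquiv u', F, ?_, ?_, ?_⟩
    · simp only [TreeMonomial.map_graft, hF, hu]
    · simp only [TreeMonomial.map_graft, hF, hu']
    · rw [levTree_graft, levTree_graft, hT]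
      simp only [he]

lemma node {s s' t t' : BinTree α} (hs : LevEq R s s') (ht : LevEq R t t') :
    LevEq R (.node s t) (.node s' t') :=
  bind (T := TreeMonomial.corolla) (T' := TreeMonomial.corolla) (s := ![s, t]) (s' := ![s', t'])
    rfl fun i => by fin_cases i <;> assumption

lemma refl (t : BinTree α) : LevEq R t t := by
  induction t with
  | leaf a => exact ⟨rfl, fun _ => ⟨1, TreeMonomial.unit, TreeMonomial.unit, fun _ => a, rfl, rfl,
      rfl⟩⟩
  | node s t hs ht => exact hs.node ht

lemma symm {t t' : BinTree α} (h : LevEq R t t') : LevEq R t' t := by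
  refine ⟨h.1.symm, fun hn => ?_⟩
  obtain ⟨n, u, u', φ, hu, hu', he⟩ := h.2 (h.1 ▸ hn)
  exact ⟨n, u', u, φ, hu', hu, he.symm⟩

/-- The middle tree has two presentations by tree monomials. As its labels are distinct, they differ
by a permutation, and relabelling along it makes the two equalities in `Lev` composable. -/
lemma trans {t t' t'' : BinTree α} (h : LevEq R t t') (h' : LevEq R t' t'') : LevEq R t t'' := by
  refine ⟨h.1.trans h'.1, fun hn => ?_⟩
  obtain ⟨n, u, u', φ, hu, hu', he⟩ := h.2 hn
  obtain ⟨n', w, w', ψ, hw, hw', he'⟩ := h'.2 (h.1 ▸ hn)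
  have h1 : (Finset.univ : Finset (Fin n')).val.map ψ =
      (Finset.univ : Finset (Fin n)).val.map φ := by
    rw [← TreeMonomial.leaves_map w, ← TreeMonomial.leaves_map u', hw, hu']
  obtain rfl : n' = n := by simpa using congrArg Multiset.card h1
  have hφ : Injective φ := by
    rw [← Fintype.nodup_map_univ_iff_injective, ← TreeMonomial.leaves_map u', hu', ← h.1]
    exact hn
  obtain ⟨σ, rfl⟩ := exists_perm_of_map_univ_eq h1 hφ
  have h2 : u' = w.relabel σ :=
    Subtype.ext (BinTree.map_injective hφ (hu'.trans (hw.symm.trans (BinTree.map_map w.1 σ φ).symm)))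
  refine ⟨n', u, w'.relabel σ, φ, hu, (BinTree.map_map w'.1 σ φ).trans hw', ?_⟩
  rw [he, h2, levTree_relabel, levTree_relabel, he']

lemma comm (s t : BinTree α) : LevEq R (.node s t) (.node t s) :=
  bind (levTree_corolla_swap R) (s := ![s, t]) (s' := ![s, t]) fun _ => refl _

lemma level (a b c d : BinTree α) : LevEq R (.node (.node a b) (.node c d))
    (.node (.node a c) (.node b d)) :=
  bind (levTree_level R) (s := ![a, b, c, d]) (s' := ![a, b, c, d]) fun _ => refl _

/-- The labels of a tree monomial are distinct, so the condition in `LevEq` is effective, and the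
labelling it provides is a permutation, which can be undone in `Lev`. -/
lemma levTree_eq {n : ℕ} {t t' : TreeMonomial n} (h : LevEq R t.1 t'.1) :
    levTree R t = levTree R t' := by
  obtain ⟨m, u, u', φ, hu, hu', he⟩ := h.2 (by rw [t.2]; exact Finset.univ.nodup)
  obtain ⟨rfl, hφ⟩ := TreeMonomial.bijective_of_map_eq hu
  let σ := Equiv.ofBijective φ hφ
  have h2 : t = u.relabel σ := Subtype.ext hu.symm
  have h3 : t' = u'.relabel σ := Subtype.ext hu'.symm
  rw [h2, h3, levTree_relabel, levTree_relabel, he]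

variable (R α) in
/-- The setoid of trees up to the relations of level algebras. -/
def setoid : Setoid (BinTree α) := ⟨LevEq R, refl, symm, trans⟩

end LevEq

/-- The class of a tree in `Lev` depends only on the depths of its leaves. -/
theorem levTree_eq_of_profile_eq {n : ℕ} {t t' : TreeMonomial n}
    (h : t.1.profile = t'.1.profile) : levTree R t = levTree R t' := by
  -- On the quotient of all trees, `node` induces an everywhere defined operation to which
  -- `LevelEval.unique` applies. This is why `LevEq` also relates trees with repeated labels, for
  -- which it only compares leaves.
  let F : BinTree (Fin n) → Quotient (LevEq.setoid R (Fin n)) := Quotient.mk _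
  let op : Quotient (LevEq.setoid R (Fin n)) → Quotient (LevEq.setoid R (Fin n)) →
      Quotient (LevEq.setoid R (Fin n)) :=
    Quotient.map₂ BinTree.node fun _ _ hs _ _ ht => LevEq.node hs ht
  have h1 := BinTree.levelEval (op := op) F (fun _ _ => rfl) t.1
  rw [h] at h1
  have h2 : F t.1 = F t'.1 := LevelEval.unique
    (fun a b => Quotient.inductionOn₂ a b fun a b => Quotient.sound (LevEq.comm a b))
    (fun a b c d => Quotient.inductionOn₂ a b fun a b => Quotient.inductionOn₂ c d fun c d =>
      Quotient.sound (LevEq.level a b c d)) h1 (BinTree.levelEval F (fun _ _ => rfl) t'.1)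
  exact LevEq.levTree_eq (Quotient.exact h2)

end LevTree

/-! ### Kernels of operad morphisms and factorization through quotients. -/

namespace Operad

variable {R : Type} [CommRing R] {P Q : Operad R}

lemma Hom.ext {f g : Hom P Q} (h : ∀ n, f.app n = g.app n) : f = g := by
  cases f
  cases g
  congr
  exact funext h

/-- The composite of two morphisms of operads. -/
def Hom.trans {S : Operad R} (f : Hom P Q) (g : Hom Q S) : Hom P S where
  app n := (g.app n).comp (f.app n)
  map_act x σ := by simp only [LinearMap.comp_apply, f.map_act, g.map_act]
  map_one := by simp only [LinearMap.comp_apply, f.map_one, g.map_one]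
  map_comp e μ ν := by simp only [LinearMap.comp_apply, f.map_comp, g.map_comp]

/-- The kernel of a morphism of operads. -/
def Hom.ker (f : Hom P Q) : OpIdeal P where
  carrier n := LinearMap.ker (f.app n)
  act_mem {n} x σ h := by
    rw [LinearMap.mem_ker] at h ⊢
    -- The action is not bundled as a linear map; compatibility with the scalar `0` shows that it
    -- preserves zero.
    have h0 := Q.act_smul (0 : R) (0 : Q.obj n) σ
    rw [zero_smul, zero_smul] at h0
    rw [f.map_act, h, h0]
  comp_mem_left e μ ν h := by
    rw [LinearMap.mem_ker] at h ⊢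
    rw [f.map_comp, h, map_zero, zero_apply]
  comp_mem_right e μ ν i h := by
    rw [LinearMap.mem_ker] at h ⊢
    rw [f.map_comp, MultilinearMap.map_coord_zero _ i h]

/-- The morphism out of a quotient induced by a morphism vanishing on the ideal. -/
noncomputable def Hom.liftQuotient (f : Hom P Q) (I : OpIdeal P)
    (h : ∀ n, I.carrier n ≤ f.ker.carrier n) : Hom (P.quotient I) Q where
  app n := (I.carrier n).liftQ (f.app n) (h n)
  map_act {n} x σ := by
    obtain ⟨x, rfl⟩ := (I.carrier n).mkQ_surjective x
    exact f.map_act x σ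
  map_one := f.map_one
  map_comp {k n m} e μ ν := by
    obtain ⟨μ, rfl⟩ := (I.carrier k).mkQ_surjective μ
    obtain ⟨ν, rfl⟩ := P.exists_mkQ I ν
    refine (congrArg _ (P.quotComp_mk I e μ ν)).trans ?_
    exact f.map_comp e μ ν

end Operad

/-! ### The monomial recording the depths of the leaves. -/

namespace BinTree

variable {α β B C : Type} [CommRing B] [CommRing C]

/-- The product, over the vertices other than the root and over the leaves, of the products of
the `g a`, for the labels `a` of the leaves above them: each `g a` appears with exponent the depth
of the leaf labelled by `a`. -/
def weight (g : α → B) : BinTree α → B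
  | leaf _ => 1
  | node s t => s.weight g * t.weight g * ((s.leaves + t.leaves).map g).prod

/-- The depth of a leaf after grafting is the depth of the leaf it was grafted on plus its depth in
the grafted tree; the two factors account for the two summands. -/
lemma weight_bind (g : β → B) (t : BinTree α) (f : α → BinTree β) :
    (t.bind f).weight g = t.weight (fun a => ((f a).leaves.map g).prod) *
      (t.leaves.map fun a => (f a).weight g).prod := by
  induction t with
  | leaf a => simp [bind, weight, leaves]
  | node s t hs ht =>
    have h : ∀ t : BinTree α, ((t.bind f).leaves.map g).prod =
        (t.leaves.map fun a => ((f a).leaves.map g).prod).prod := fun t => by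
      rw [leaves_bind, Multiset.map_bind, Multiset.prod_bind]
    simp only [bind, weight, leaves, hs, ht, Multiset.map_add, Multiset.prod_add, h]
    ring

lemma weight_map (g : β → B) (t : BinTree α) (f : α → β) :
    (t.map f).weight g = t.weight fun a => g (f a) := by
  induction t with
  | leaf a => rfl
  | node s t hs ht =>
    have h : (node s t).map f = node (s.map f) (t.map f) := rfl
    rw [h, weight, weight, hs, ht, leaves_map, leaves_map, ← Multiset.map_add, Multiset.map_map]
    rfl

lemma map_weight {F : Type} [FunLike F B C] [RingHomClass F B C] (φ : F) (g : α → B)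
    (t : BinTree α) : φ (t.weight g) = t.weight fun a => φ (g a) := by
  induction t with
  | leaf a => exact map_one φ
  | node s t hs ht =>
    rw [weight, weight, map_mul, map_mul, hs, ht, map_multiset_prod, Multiset.map_map]
    rfl

/-- A new root multiplies the weight by one more `g a` for each leaf, exactly as `deepen` raises
each exponent by one. -/
lemma weight_eq_prod_profile (g : α → B) (t : BinTree α) :
    t.weight g = (t.profile.map fun p => g p.1 ^ p.2).prod := by
  induction t with
  | leaf a => simp [weight, profile]
  | node s t hs ht =>
    rw [weight, hs, ht, profile, Multiset.map_map, ← profile_map_fst, ← profile_map_fst]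
    simp only [deepen, Function.comp_def, pow_succ, Multiset.prod_map_mul, Multiset.map_add,
      Multiset.prod_add, Multiset.map_map]
    ring

end BinTree

lemma TreeMonomial.pos {n : ℕ} (t : TreeMonomial n) : 0 < n := by
  have h : ∀ t : BinTree (Fin n), ∃ i, i ∈ t.leaves := by
    intro t
    induction t with
    | leaf a => exact ⟨a, Multiset.mem_singleton_self _⟩
    | node s t hs ht => exact hs.imp fun i hi => Multiset.mem_add.2 (Or.inl hi)
  obtain ⟨i, _⟩ := h t.1
  exact Fin.pos i

/-! ### The morphism from `Lev` to `Com ∘ A`. -/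

section LevHom

variable (R : Type) [CommRing R] (A : Type) [CommRing A] [Algebra R A] [DiagonalAlgebra R A]

/-- The image of a tree monomial in `Com ∘ A`. -/
noncomputable def comTree {n : ℕ} (t : TreeMonomial n) : (ComOver R A).obj n :=
  comWrap R n (t.1.weight (TPow.gen R A))

lemma comTree_relabel {n : ℕ} (σ : Equiv.Perm (Fin n)) (t : TreeMonomial n) :
    comTree R A (t.relabel σ) = (ComOver R A).act (comTree R A t) σ.symm := by
  have h : (ComOver R A).act (comTree R A t) σ.symm =
      comWrap R n (TPow.slotMap R σ (t.1.weight (TPow.gen R A))) := rfl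
  rw [h, BinTree.map_weight, comTree, TreeMonomial.relabel, BinTree.weight_map]
  simp only [TPow.slotMap_gen]
  rfl

/-- The two factors in `BinTree.weight_bind` are those of the composition of `Com ∘ A`: `spread`
distributes the powers of `d` coming from `t` over the inputs of each `s i`, and the maps `slotMap`
place the powers coming from the `s i`. -/
lemma comTree_graft {k n : ℕ} {m : Fin k → ℕ} (e : (Σ i, Fin (m i)) ≃ Fin n)
    (t : TreeMonomial k) (s : ∀ i, TreeMonomial (m i)) :
    comTree R A (t.graft e s) =
      (ComOver R A).comp e (comTree R A t) fun i => comTree R A (s i) := by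
  refine Eq.trans ?_ (comComp_eq R e (fun i => (s i).pos) _ _).symm
  have h1 := comStrip_comWrap R t.pos (t.1.weight (TPow.gen R A))
  have h2 : ∀ i, comStrip R (m i) (comWrap R (m i) ((s i).1.weight (TPow.gen R A))) = _ :=
    fun i => comStrip_comWrap R (s i).pos _
  simp only [comTree, h1, h2, TPow.comp, BinTree.map_weight, TPow.slotMap_gen, TPow.spread_gen,
    TreeMonomial.graft, BinTree.weight_bind, BinTree.weight_map, BinTree.leaves_map,
    Multiset.map_map, (s _).2, t.2]
  rfl

/-- The morphism from the magmatic operad to `Com ∘ A` sending the generator to `(·; d, d)`. -/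
noncomputable def magHom : Operad.Hom (Operad.mag R) (ComOver R A) where
  app n := Finsupp.linearCombination R (comTree R A)
  map_act {n} x σ := by
    refine Operad.finsupp_ext R
      (F := fun x => Finsupp.linearCombination R (comTree R A) (Operad.magAct R σ x))
      (G := fun x => comAct R σ (Finsupp.linearCombination R (comTree R A) x))
      ((Finsupp.linearCombination R _).comp (Operad.magAct R σ)).isLinear
      ((comAct R σ).comp (Finsupp.linearCombination R (comTree R A))).isLinear (fun t => ?_) x
    simp only [Operad.magAct_single, Finsupp.linearCombination_single, one_smul]
    exact comTree_relabel R A σ.symm t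
  map_one := by
    refine (Finsupp.linearCombination_single _ _ _).trans ?_
    rw [one_smul]
    rfl
  map_comp {k n m} e μ ν := by
    refine Operad.finsupp_ext R
      (F := fun μ => Finsupp.linearCombination R (comTree R A) (Operad.magComp R e μ ν))
      (G := fun μ => comComp R e (Finsupp.linearCombination R (comTree R A) μ)
        fun i => Finsupp.linearCombination R (comTree R A) (ν i))
      ⟨fun x y => ?_, fun c x => ?_⟩ ⟨fun x y => ?_, fun c x => ?_⟩ (fun t => ?_) μ
    · rw [map_add (Operad.magComp R e)]
      exact map_add (Finsupp.linearCombination R (comTree R A)) _ _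
    · rw [map_smul (Operad.magComp R e)]
      exact map_smul (Finsupp.linearCombination R (comTree R A)) _ _
    · rw [map_add (Finsupp.linearCombination R (comTree R A))]
      exact DFunLike.congr_fun (map_add (comComp R e) _ _) _
    · rw [map_smul (Finsupp.linearCombination R (comTree R A))]
      exact DFunLike.congr_fun (map_smul (comComp R e) _ _) _
    refine multi_ext
      (F := fun ν => Finsupp.linearCombination R (comTree R A) (Operad.magComp R e _ ν))
      (G := fun ν => comComp R e (Finsupp.linearCombination R (comTree R A) (Finsupp.single t 1))
        fun i => Finsupp.linearCombination R (comTree R A) (ν i))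
      (fun ν i => ((Finsupp.linearCombination R (comTree R A)).comp
        ((Operad.magComp R e _).toLinearMap ν i)).isLinear) (fun ν i => ?_) (fun s => ?_) ν
    · exact (((comComp R e _).compLinearMap
        fun i => Finsupp.linearCombination R (comTree R A (n := m i))).toLinearMap ν i).isLinear
    · simp only [Operad.magComp_single, Finsupp.linearCombination_single, one_smul]
      exact comTree_graft R A e t s

lemma magHom_magTree {n : ℕ} (t : TreeMonomial n) :
    (magHom R A).app n (magTree R t) = comTree R A t :=
  (Finsupp.linearCombination_single R (1 : R) t).trans (one_smul _ _)

lemma comTree_corolla : comTree R A TreeMonomial.corolla = comOverOp R A := by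
  refine congrArg (comWrap R 2) ?_
  rw [← DiagonalAlgebra.diag_d 2 Nat.two_pos, TPow.diag_eq_prod]
  simp [TreeMonomial.corolla, BinTree.weight, BinTree.leaves, Fin.prod_univ_two]

/-- Both relations preserve depths: every leaf has depth one in the first, and depth two in the
second. -/
lemma levIdeal_le_ker (n : ℕ) : (levIdeal R).carrier n ≤ (magHom R A).ker.carrier n := by
  refine Operad.OpIdeal.generate_le _ (fun n x hx => ?_) n
  have hsub : ∀ {n : ℕ} (x y : (Operad.mag R).obj n),
      (magHom R A).app n x = (magHom R A).app n y → x - y ∈ (magHom R A).ker.carrier n :=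
    fun x y h => LinearMap.mem_ker.2 (by rw [map_sub, h, sub_self])
  cases hx with
  | comm =>
    refine hsub _ _ ?_
    rw [Operad.Hom.map_act, magHom_magTree]
    refine Eq.trans ?_ (comTree_relabel R A (Equiv.swap 0 1) TreeMonomial.corolla)
    refine congrArg (comWrap R 2) ?_
    simp [TreeMonomial.corolla, TreeMonomial.relabel, BinTree.weight, BinTree.leaves,
      BinTree.map, BinTree.bind, mul_comm]
  | level =>
    refine hsub _ _ ?_
    rw [Operad.Hom.map_act, Operad.Hom.map_comp]
    simp only [magHom_magTree]
    have h := comTree_graft R A fourEquiv TreeMonomial.corolla fun _ => TreeMonomial.corolla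
    rw [← h]
    refine Eq.trans ?_ (comTree_relabel R A (Equiv.swap 1 2) _)
    refine congrArg (comWrap R 4) ?_
    have h0 : (TreeMonomial.corolla.graft fourEquiv fun _ => TreeMonomial.corolla).1 =
      .node (.node (.leaf 0) (.leaf 1)) (.node (.leaf 2) (.leaf 3)) := rfl
    have h1 : ((TreeMonomial.corolla.graft fourEquiv fun _ => TreeMonomial.corolla).relabel
        (Equiv.swap 1 2)).1 =
      .node (.node (.leaf 0) (.leaf 2)) (.node (.leaf 1) (.leaf 3)) := rfl
    rw [h0, h1]
    simp only [BinTree.weight, BinTree.leaves, Multiset.map_add, Multiset.map_singleton,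
      Multiset.prod_add, Multiset.prod_singleton]
    ring

/-- The morphism from `Lev` to `Com ∘ A` sending the generator to `(·; d, d)`. -/
noncomputable def levHom : Operad.Hom (Lev R) (ComOver R A) :=
  (magHom R A).liftQuotient (levIdeal R) (levIdeal_le_ker R A)

lemma levHom_levTree {n : ℕ} (t : TreeMonomial n) :
    (levHom R A).app n (levTree R t) = comTree R A t :=
  magHom_magTree R A t

lemma levHom_levStar : (levHom R A).app 2 (levStar R) = comOverOp R A :=
  (levHom_levTree R A _).trans (comTree_corolla R A)

end LevHom

/-! ### Generation of `Lev` by `⋆` and uniqueness of the morphism. -/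

/-- Induction on tree monomials. -/
lemma TreeMonomial.induction {P : ∀ n, TreeMonomial n → Prop} (unit : P 1 TreeMonomial.unit)
    (graft : ∀ (m : Fin 2 → ℕ) (n : ℕ) (e : (Σ i, Fin (m i)) ≃ Fin n)
      (s : ∀ i, TreeMonomial (m i)), (∀ i, P (m i) (s i)) → P n (corolla.graft e s))
    (relabel : ∀ (n : ℕ) (σ : Equiv.Perm (Fin n)) (t : TreeMonomial n), P n t → P n (t.relabel σ))
    {n : ℕ} (t : TreeMonomial n) : P n t := by
  -- The subtrees of a tree monomial are labelled by only part of `Fin n`, so structural induction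
  -- needs arbitrary labels. The permutation by which the result differs from `t` is absorbed at the
  -- end by `relabel`.
  have key : ∀ {α : Type} (t : BinTree α), ∃ (m : ℕ) (u : TreeMonomial m) (φ : Fin m → α),
      u.1.map φ = t ∧ P m u := by
    intro α t
    induction t with
    | leaf a => exact ⟨1, TreeMonomial.unit, fun _ => a, rfl, unit⟩
    | node s t hs ht =>
      have h : ∀ i : Fin 2, ∃ (m : ℕ) (u : TreeMonomial m) (φ : Fin m → α),
          u.1.map φ = ![s, t] i ∧ P m u := fun i => by fin_cases i <;> assumption
      choose m u φ hu hP using h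
      obtain ⟨F, hF⟩ := exists_finSigma_desc φ
      refine ⟨_, corolla.graft finSigmaFinEquiv u, F, ?_, graft _ _ _ _ hP⟩
      simp only [map_graft, hF, hu]
      rfl
  obtain ⟨m, u, φ, hu, hP⟩ := key t.1
  obtain ⟨rfl, hφ⟩ := bijective_of_map_eq hu
  have h : t = u.relabel (Equiv.ofBijective φ hφ) := Subtype.ext hu.symm
  rw [h]
  exact relabel _ _ _ hP

section Uniqueness

variable {R : Type} [CommRing R]

/-- The classes of trees span `Lev`, and each is obtained from `⋆` and the identity by composition
and relabelling. -/
lemma Lev.hom_ext {Q : Operad R} {f g : Operad.Hom (Lev R) Q}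
    (h : f.app 2 (levStar R) = g.app 2 (levStar R)) : f = g := by
  have key : ∀ {n : ℕ} (t : TreeMonomial n),
      f.app n (levTree R t) = g.app n (levTree R t) := by
    intro n t
    induction t using TreeMonomial.induction with
    | unit => rw [levTree_unit, f.map_one, g.map_one]
    | graft m n e s ih =>
      rw [levTree_graft, f.map_comp, g.map_comp]
      simp only [ih]
      exact congrArg (fun x => Q.comp e x _) h
    | relabel n σ t ih => rw [levTree_relabel, f.map_act, g.map_act, ih]
  refine Operad.Hom.ext fun n => ?_
  refine Submodule.linearMap_qext _ (Finsupp.lhom_ext' fun t => LinearMap.ext_ring ?_)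
  exact key t

end Uniqueness

/-! ### Depth functions of tree monomials. -/

namespace TreeMonomial

/-- Each label occurs exactly once. The graph of a choice of depths is thus contained in the profile
and has the same cardinality. -/
lemma exists_depth {n : ℕ} (t : TreeMonomial n) :
    ∃ δ : Fin n → ℕ, t.1.profile = (Finset.univ : Finset (Fin n)).val.map fun i => (i, δ i) := by
  have h : t.1.profile.map Prod.fst = (Finset.univ : Finset (Fin n)).val := by
    rw [BinTree.profile_map_fst, t.2]
  have h1 : ∀ i, ∃ d, (i, d) ∈ t.1.profile := fun i => by
    have h2 := Finset.mem_univ_val i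
    rw [← h, Multiset.mem_map] at h2
    obtain ⟨⟨j, d⟩, hp, rfl⟩ := h2
    exact ⟨d, hp⟩
  choose δ hδ using h1
  refine ⟨δ, (Multiset.eq_of_le_of_card_le ?_ ?_).symm⟩
  · refine (Multiset.le_iff_subset ?_).2 fun p hp => ?_
    · exact Finset.univ.nodup.map fun i j hij => congrArg Prod.fst hij
    · obtain ⟨i, _, rfl⟩ := Multiset.mem_map.1 hp
      exact hδ i
  · rw [Multiset.card_map]
    exact (Multiset.card_map Prod.fst t.1.profile).symm.trans_le (congrArg Multiset.card h).le

/-- The depths of the leaves of a tree monomial. -/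
noncomputable def depth {n : ℕ} (t : TreeMonomial n) : Fin n → ℕ := t.exists_depth.choose

lemma profile_eq {n : ℕ} (t : TreeMonomial n) :
    t.1.profile = (Finset.univ : Finset (Fin n)).val.map fun i => (i, t.depth i) :=
  t.exists_depth.choose_spec

lemma depth_le_height {n : ℕ} (t : TreeMonomial n) (i : Fin n) : t.depth i ≤ t.1.height := by
  refine BinTree.le_height_of_mem_profile (t := t.1) (p := (i, t.depth i)) ?_
  rw [profile_eq]
  exact Multiset.mem_map_of_mem _ (Finset.mem_univ_val i)

/-- Together with `depth_le_height`, this makes the height the largest depth, which matches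
truncation by height with truncation of the powers of `d`. -/
lemma exists_depth_eq_height {n : ℕ} (t : TreeMonomial n) : ∃ i, t.depth i = t.1.height := by
  obtain ⟨i, hi⟩ := t.1.exists_mem_profile_height
  rw [profile_eq, Multiset.mem_map] at hi
  obtain ⟨j, _, hj⟩ := hi
  exact ⟨j, congrArg Prod.snd hj⟩

end TreeMonomial

/-! ### Separation of the monomials in `d` and injectivity. -/

section Injectivity

variable (R : Type) [CommRing R] (A : Type) [CommRing A] [Algebra R A] [DiagonalAlgebra R A]

lemma TPow.prod_gen_pow {n : ℕ} (δ : Fin n → ℕ) :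
    ∏ i, TPow.gen R A i ^ δ i =
      PiTensorProduct.tprod R fun i => (DiagonalAlgebra.d R : A) ^ δ i := by
  have h : ∀ i, TPow.gen R A i ^ δ i =
      PiTensorProduct.tprod R (Pi.mulSingle i ((DiagonalAlgebra.d R : A) ^ δ i)) := fun i =>
    (map_pow (TPow.single R i) (DiagonalAlgebra.d R) (δ i)).symm
  simp only [h]
  rw [← PiTensorProduct.tprod_prod]
  congr 1
  exact Finset.univ_prod_mulSingle fun i => (DiagonalAlgebra.d R : A) ^ δ i

/-- The element `(μ; d ^ δ₁, …, d ^ δ_n)`, where `μ` is the `n`-fold product. -/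
noncomputable def comPow {n : ℕ} (δ : Fin n → ℕ) : (ComOver R A).obj n :=
  comWrap R n (PiTensorProduct.tprod R fun i => (DiagonalAlgebra.d R : A) ^ δ i)

lemma comTree_eq_comPow {n : ℕ} (t : TreeMonomial n) : comTree R A t = comPow R A t.depth := by
  rw [comTree, BinTree.weight_eq_prod_profile, t.profile_eq, Multiset.map_map, comPow,
    ← TPow.prod_gen_pow]
  rfl

lemma comPow_eq_zero {n : ℕ} {δ : Fin n → ℕ} (i : Fin n)
    (h : (DiagonalAlgebra.d R : A) ^ δ i = 0) : comPow R A δ = 0 := by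
  rw [comPow, (PiTensorProduct.tprod R).map_coord_zero i h]
  exact map_zero _

variable {A} in
/-- The linear form on `Com(n) ⊗ A^{⊗ n}` given by the product of `n` linear forms on `A`. -/
noncomputable def comForm {n : ℕ} (κ : Fin n → A →ₗ[R] R) : (ComOver R A).obj n →ₗ[R] R :=
  (PiTensorProduct.lift ((MultilinearMap.mkPiAlgebra R (Fin n) R).compLinearMap κ)).comp
    (comStrip R n)

-- Positivity of `n` matters: `Com(0) = 0`, so in arity zero the form vanishes whereas the empty
-- product is `1`.
variable {A} in
lemma comForm_comPow {n : ℕ} (hn : 0 < n) (κ : Fin n → A →ₗ[R] R) (δ : Fin n → ℕ) :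
    comForm R κ (comPow R A δ) = ∏ i, κ i (DiagonalAlgebra.d R ^ δ i) := by
  change PiTensorProduct.lift ((MultilinearMap.mkPiAlgebra R (Fin n) R).compLinearMap κ)
    (comStrip R n (comWrap R n
      (PiTensorProduct.tprod R fun i => (DiagonalAlgebra.d R : A) ^ δ i))) = _
  rw [comStrip_comWrap R hn, PiTensorProduct.lift.tprod]
  rfl

lemma exists_eq_linearCombination_levTree {n : ℕ} (x : (Lev R).obj n) :
    ∃ c : TreeMonomial n →₀ R, x = Finsupp.linearCombination R (levTree R) c := by
  obtain ⟨c, rfl⟩ := ((levIdeal R).carrier n).mkQ_surjective x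
  have h : ((levIdeal R).carrier n).mkQ = Finsupp.linearCombination R (levTree R (n := n)) :=
    Finsupp.lhom_ext' fun t => LinearMap.ext_ring
      ((Finsupp.linearCombination_single R (1 : R) t).trans (one_smul R (levTree R t))).symm
  exact ⟨c, DFunLike.congr_fun h c⟩

open scoped Classical in
/-- An element of `Lev` with zero image in `Com ∘ A` is a combination of trees having a leaf whose
depth is not in `K`, if the powers `d ^ k` with `k ∈ K` are separated by linear forms vanishing on
the other powers of `d`. -/
theorem mem_span_of_levHom_eq_zero {K : Set ℕ} (κ : ℕ → A →ₗ[R] R)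
    (hκ : ∀ k ∈ K, ∀ j, κ k (DiagonalAlgebra.d R ^ j) = if j = k then 1 else 0)
    {n : ℕ} (x : (Lev R).obj n) (hx : (levHom R A).app n x = 0) :
    x ∈ Submodule.span R {y | ∃ t : TreeMonomial n, (∃ i, t.depth i ∉ K) ∧ y = levTree R t} := by
  obtain ⟨c, rfl⟩ := exists_eq_linearCombination_levTree R x
  rcases Nat.eq_zero_or_pos n with rfl | hn
  · have h0 : c = 0 := Finsupp.ext fun t => absurd t.pos (lt_irrefl 0)
    rw [h0, map_zero]
    exact zero_mem _
  -- A tree is chosen for each depth function that occurs. By `levTree_eq_of_profile_eq` its class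
  -- does not depend on the choice. The value `0` elsewhere makes the functions that are not depths
  -- of trees harmless.
  let b : (Fin n → ℕ) → (Lev R).obj n := fun δ =>
    if h : ∃ t : TreeMonomial n, t.depth = δ then levTree R h.choose else 0
  have hb : ∀ t : TreeMonomial n, b t.depth = levTree R t := fun t => by
    have h : ∃ s : TreeMonomial n, s.depth = t.depth := ⟨t, rfl⟩
    refine (dif_pos h).trans (levTree_eq_of_profile_eq R ?_)
    rw [TreeMonomial.profile_eq, TreeMonomial.profile_eq, h.choose_spec]
  have hy0 : Finsupp.linearCombination R (comPow R A) (c.mapDomain TreeMonomial.depth) = 0 := by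
    rw [Finsupp.linearCombination_mapDomain, ← hx, Finsupp.apply_linearCombination]
    exact congrArg (fun v => Finsupp.linearCombination R v c)
      (funext fun t => ((levHom_levTree R A t).trans (comTree_eq_comPow R A t)).symm)
  have hyb : Finsupp.linearCombination R (levTree R) c =
      Finsupp.linearCombination R b (c.mapDomain TreeMonomial.depth) := by
    rw [Finsupp.linearCombination_mapDomain]
    exact congrArg (fun v => Finsupp.linearCombination R v c) (funext fun t => (hb t).symm)
  rw [hyb]
  -- Coefficients of trees with equal depths have been added up in `y`. What remains is a linear
  -- relation between monomials in `d`, indexed by functions `δ`.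
  generalize c.mapDomain TreeMonomial.depth = y at hy0
  rw [Finsupp.linearCombination_apply]
  refine Submodule.sum_mem _ fun δ _ => ?_
  by_cases hδ : ∀ i, δ i ∈ K
  · have h1 : y δ = 0 := by
      -- The product of the forms `κ (δ i)` is `1` on the monomial with exponents `δ`, and `0` on
      -- any other, because of a coordinate where the exponents differ. It extracts the coefficient
      -- `y δ`.
      have h2 := congrArg (comForm R fun i => κ (δ i)) hy0
      rw [map_zero, Finsupp.apply_linearCombination] at h2
      rw [← h2, Finsupp.linearCombination_apply, Finsupp.sum, Finset.sum_eq_single δ]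
      · simp [comForm_comPow R hn, hκ _ (hδ _)]
      · intro δ' _ hne
        obtain ⟨i, hi⟩ := Function.ne_iff.1 hne
        rw [comp_apply, comForm_comPow R hn, Finset.prod_eq_zero (Finset.mem_univ i), smul_zero]
        rw [hκ _ (hδ i), if_neg hi]
      · intro h
        rw [Finsupp.notMem_support_iff.1 h, zero_smul]
    simp only [h1, zero_smul]
    exact zero_mem _
  · refine Submodule.smul_mem _ _ ?_
    push Not at hδ
    by_cases h : ∃ t : TreeMonomial n, t.depth = δ
    · obtain ⟨t, rfl⟩ := h
      rw [hb]
      exact Submodule.subset_span ⟨t, hδ, rfl⟩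
    · rw [show b δ = 0 from dif_neg h]
      exact zero_mem _

variable {R A} in
lemma levHom_injective (κ : ℕ → A →ₗ[R] R)
    (hκ : ∀ k j, κ k (DiagonalAlgebra.d R ^ j) = if j = k then 1 else 0) (n : ℕ) :
    Injective ((levHom R A).app n) := by
  refine (injective_iff_map_eq_zero _).2 fun x hx => ?_
  have h := mem_span_of_levHom_eq_zero R A (K := Set.univ) κ (fun k _ => hκ k) x hx
  simpa using h

lemma levHom_polynomial_injective (n : ℕ) : Injective ((levHom R R[X]).app n) :=
  levHom_injective (Polynomial.lcoeff R) (fun k j => by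
    change (Polynomial.X ^ j : R[X]).coeff k = _
    rw [Polynomial.coeff_X_pow]
    simp only [eq_comm]) n

lemma levHom_laurent_injective (n : ℕ) : Injective ((levHom R R[T;T⁻¹]).app n) := by
  -- Depths are natural numbers, so only the coefficients of nonnegative powers are needed.
  refine levHom_injective (fun k => (Finsupp.lapply (k : ℤ)).comp
    (AddMonoidAlgebra.coeffLinearEquiv R).toLinearMap) (fun k j => ?_) n
  change (LaurentPolynomial.T 1 ^ j : R[T;T⁻¹]).coeff k = _
  rw [LaurentPolynomial.T_pow, LaurentPolynomial.T_apply]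
  simp

end Injectivity

/-! ### Truncation by height. -/

section Truncation

variable (R : Type) [CommRing R] (q : ℕ)

open DiagonalAlgebra (TruncPoly)

lemma truncPoly_d_pow_eq_zero {j : ℕ} (h : q < j) :
    (DiagonalAlgebra.d R : TruncPoly R q) ^ j = 0 := by
  change (Ideal.Quotient.mk _ Polynomial.X) ^ j = _
  rw [← map_pow, Ideal.Quotient.eq_zero_iff_mem, Ideal.mem_span_singleton]
  exact pow_dvd_pow _ h

/-- The coefficient of `d ^ k` in `R[d] / (d ^ (q + 1))`, for `k ≤ q`. -/
noncomputable def truncCoeff (k : ℕ) (h : k ≤ q) : TruncPoly R q →ₗ[R] R :=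
  (((Ideal.span {(Polynomial.X : R[X]) ^ (q + 1)}).restrictScalars R).liftQ
    (Polynomial.lcoeff R k) (by
      intro p hp
      obtain ⟨r, rfl⟩ := Ideal.mem_span_singleton.1 hp
      rw [LinearMap.mem_ker, Polynomial.lcoeff_apply, Polynomial.coeff_X_pow_mul', if_neg]
      omega)).comp
    (Submodule.Quotient.restrictScalarsEquiv R
      (Ideal.span {(Polynomial.X : R[X]) ^ (q + 1)})).symm.toLinearMap

lemma truncCoeff_d_pow (k : ℕ) (h : k ≤ q) (j : ℕ) :
    truncCoeff R q k h (DiagonalAlgebra.d R ^ j) = if j = k then 1 else 0 := by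
  change (Polynomial.X ^ j : R[X]).coeff k = _
  rw [Polynomial.coeff_X_pow]
  simp only [eq_comm]

/-- A leaf whose depth is the height of the tree contributes a factor `d ^ j` with `j > q`, which is
zero. -/
lemma truncIdeal_le_ker (n : ℕ) :
    (truncIdeal R q).carrier n ≤ (levHom R (TruncPoly R q)).ker.carrier n := by
  refine Operad.OpIdeal.generate_le _ (fun n x hx => ?_) n
  obtain ⟨t, ht, rfl⟩ := hx
  obtain ⟨i, hi⟩ := t.exists_depth_eq_height
  refine LinearMap.mem_ker.2 ?_
  rw [levHom_levTree, comTree_eq_comPow]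
  exact comPow_eq_zero R _ i (truncPoly_d_pow_eq_zero R q (by rw [hi]; exact ht))

/-- The morphism from `T_q Lev` to `Com ∘ T_q D` sending the generator to `(·; d, d)`. -/
noncomputable def truncLevHom : Operad.Hom (TLev R q) (ComOver R (TruncPoly R q)) :=
  (levHom R (TruncPoly R q)).liftQuotient (truncIdeal R q) (truncIdeal_le_ker R q)

/-- Both morphisms send `⋆` to `(·; d, d)`, so they agree by uniqueness. Hence `truncLevHom`, built
directly on `T_q D`, is the morphism induced by `f`. -/
lemma levHom_trans_truncProj :
    (levHom R R[X]).trans (ComOver.truncProj R q) = levHom R (TruncPoly R q) := by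
  refine Lev.hom_ext ?_
  rw [levHom_levStar]
  refine (congrArg _ (levHom_levStar R R[X])).trans ?_
  refine (LinearMap.lTensor_tmul _ _ _ _).trans ?_
  rw [TPow.mapHom_toLinearMap, PiTensorProduct.map_tprod]
  rfl

/-- Only the exponents up to `q` are separated, so an element of the kernel is a combination of
trees with a leaf of depth greater than `q`. Such trees have height greater than `q` and already
vanish in `T_q Lev`. -/
lemma truncLevHom_injective (n : ℕ) : Injective ((truncLevHom R q).app n) := by
  refine (injective_iff_map_eq_zero _).2 fun x hx => ?_
  obtain ⟨x, rfl⟩ := ((truncIdeal R q).carrier n).mkQ_surjective x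
  refine (Submodule.Quotient.mk_eq_zero _).2 ?_
  have h := mem_span_of_levHom_eq_zero R (TruncPoly R q) (K := Set.Iic q)
    -- The value `0` for `k > q` plays no role, since such `k` are not in `K`.
    (fun k => if h : k ≤ q then truncCoeff R q k h else 0)
    (fun k hk j => by rw [dif_pos (Set.mem_Iic.1 hk), truncCoeff_d_pow]) x hx
  refine Submodule.span_le.2 ?_ h
  rintro _ ⟨t, ⟨i, hi⟩, rfl⟩
  exact Operad.OpIdeal.subset_generate (Lev R) _
    ⟨t, (not_le.1 hi).trans_le (t.depth_le_height i), rfl⟩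

end Truncation

theorem mainTheorem7 :
    (∃ f : Operad.Hom (Lev (ZMod 2)) (ComOver (ZMod 2) (ZMod 2)[X]),
      f.app 2 (levStar (ZMod 2)) = comOverOp (ZMod 2) (ZMod 2)[X] ∧
      (∀ f' : Operad.Hom (Lev (ZMod 2)) (ComOver (ZMod 2) (ZMod 2)[X]),
        f'.app 2 (levStar (ZMod 2)) = comOverOp (ZMod 2) (ZMod 2)[X] → f' = f) ∧
      (∀ n, Function.Injective (f.app n)) ∧
      ∀ q : ℕ, ∃ g : Operad.Hom (TLev (ZMod 2) q)
          (ComOver (ZMod 2) (DiagonalAlgebra.TruncPoly (ZMod 2) q)),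
        (∀ n (x : (Lev (ZMod 2)).obj n),
          g.app n ((TLev.proj (ZMod 2) q).app n x) =
            (ComOver.truncProj (ZMod 2) q).app n (f.app n x)) ∧
        ∀ n, Function.Injective (g.app n)) ∧
    (∃ f : Operad.Hom (Lev (ZMod 2)) (ComOver (ZMod 2) (ZMod 2)[T;T⁻¹]),
      f.app 2 (levStar (ZMod 2)) = comOverOp (ZMod 2) (ZMod 2)[T;T⁻¹] ∧
      (∀ f' : Operad.Hom (Lev (ZMod 2)) (ComOver (ZMod 2) (ZMod 2)[T;T⁻¹]),
        f'.app 2 (levStar (ZMod 2)) = comOverOp (ZMod 2) (ZMod 2)[T;T⁻¹] → f' = f) ∧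
      ∀ n, Function.Injective (f.app n)) := by
  refine ⟨⟨levHom _ _, levHom_levStar _ _, fun f' h => Lev.hom_ext (h.trans
      (levHom_levStar _ _).symm), levHom_polynomial_injective _, fun q =>
      ⟨truncLevHom _ q, fun n x => ?_, truncLevHom_injective _ q⟩⟩,
    ⟨levHom _ _, levHom_levStar _ _, fun f' h => Lev.hom_ext (h.trans
      (levHom_levStar _ _).symm), levHom_laurent_injective _⟩⟩
  exact (congrArg (fun h => Operad.Hom.app h n x) (levHom_trans_truncProj (ZMod 2) q)).symm
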